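/- **Setting.** Let $\mathbb A$ be a real alternative $*$-algebra: a finite-dimensional real algebra with unit, alternative but not necessarily associative, with an anti-involution $a\mapsto a^c$ (real-linear, $(a^c)^c=a$, $(ab)^c=b^ca^c$, and $a^c=a$ for $a\in\mathbb R$). Let $m\ge1$ and let $v_0=1,v_1,\dots,v_m\in\mathbb A$ be linearly independent with $v_s+v_s^c=0$, $v_sv_s^c=1$ for $1\le s\le m$ and $v_sv_t=-v_tv_s$ for distinct $s,t\in\{1,\dots,m\}$. Complete them to a real basis of $\mathbb A$, and let $|\cdot|$ be the Euclidean norm on $\mathbb A$ attached to that basis. Put $M=\mathrm{span}_{\mathbb R}(v_0,\dots,v_m)$, let $n\ge1$, $N=(m+1)n$, and identify $M^n$ with the Euclidean space $\mathbb R^N$ by $x=(x_1,\dots,x_n)$, $x_j=\sum_{s=0}^m x_{j,s}v_s$. Let $\Omega\subset M^n$ be a bounded domain with piecewise smooth boundary $\Gamma=\partial\Omega$. Here this means: (i) $\Gamma$ is a finite union of patches $\varphi_i(D_i)$, with $D_i\subset\mathbb R^{N-1}$ compact, $\partial D_i$ Lebesgue-null and $\varphi_i$ bi-Lipschitz on $D_i$,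 such that near every point of $\varphi_i(\mathrm{int}\,D_i)$ the set $\Omega$ is of the form $\{\rho<0\}$ for a real $C^1$ function $\rho$ that vanishes at that point and has non-zero gradient there; (ii) $\Gamma$ has no cusps: every point of $\Gamma$ is the vertex of a truncated open cone contained in $\Omega$ and of one contained in $\Omega^-:=M^n\setminus\overline\Omega$. Let $dS$ be the surface measure on $\Gamma$ (the normalised $(N-1)$-dimensional Hausdorff measure) and let $\nu=(\nu_1,\dots,\nu_n)$, with $\nu_j(y)\in M$, be the unit exterior normal, defined $dS$-almost everywhere. For $f:\Gamma\to\mathbb A$ and $x\in M^n\setminus\Gamma$ let $$C_\Gamma[f](x)=\int_\Gamma\sum_{j=1}^n K_j(y-x)\,\bigl(\nu_j(y)f(y)\bigr)\,dS(y),\qquad K_j(x)=\frac1{\sigma_N}\frac{x_j^c}{|x|^N},$$ where $\sigma_N=2\pi^{N/2}/\Gamma(N/2)$ (with the Euler Gamma function) is the area of the unit sphere of $\mathbb R^N$ and the integral is taken componentwise. For $x\in\Gamma$ and $D\in\{\Omega,\Omega^-\}$, a function $F$ on $D$ has the non-tangential limit $L$ at $x$ from $D$ if $x$ is an accumulation point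 of the region $\{x'\in D:\ |x'-x|\le\kappa\,\mathrm{dist}(x',\Gamma)\}$ for some $\kappa$, and if for every $\kappa$ one has $F(x')\to L$ as $x'\to x$ within that region. **Corollary (jump formula).** Let $0<\alpha<1$ and let $f:\Gamma\to\mathbb A$ satisfy the Hölder condition $|f(x)-f(x')|\le C|x-x'|^\alpha$ for all $x,x'\in\Gamma$, with some constant $C$. Then at every $x\in\Gamma$ the non-tangential limits $$C^+_\Gamma[f](x)=\mathop{\mathrm{n.t.}\lim}_{\Omega\ni x'\to x}C_\Gamma[f](x'),\qquad C^-_\Gamma[f](x)=\mathop{\mathrm{n.t.}\lim}_{\Omega^-\ni x'\to x}C_\Gamma[f](x')$$ exist, and $$C^+_\Gamma[f](x)-C^-_\Gamma[f](x)=f(x).$$ -/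

import Mathlib

open MeasureTheory Filter Topology

noncomputable section

namespace BochnerMartinelli

/-! ### Real alternative `*`-algebras and hypercomplex bases -/

/-- Left and right alternativity of a (not necessarily associative) multiplication. -/
structure IsAlternative (A : Type*) [Mul A] : Prop where
  left_alt : ∀ a b : A, (a * a) * b = a * (a * b)
  right_alt : ∀ a b : A, (b * a) * a = b * (a * a)

/-- The sphere of imaginary units: `t(x) = x + x^c = 0` and `n(x) = x x^c = 1`. -/
def imaginaryUnits (A : Type*) [NonAssocRing A] [StarRing A] : Set A :=
  {x | x + star x = 0 ∧ x * star x = 1}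

variable {A : Type*} [NonAssocRing A] [Module ℝ A] [StarRing A] {m k n : ℕ}

/-- The first `m + 1` vectors of the real basis `b` of `A` (those with index `Sum.inl s`) form a
hypercomplex basis `(v₀, …, vₘ)`; the others complete it to a basis of `A`. The hypercomplex
subspace `M` is the span of `v₀, …, vₘ`. -/
structure IsHypercomplexBasis (b : Module.Basis (Fin (m + 1) ⊕ Fin k) ℝ A) : Prop where
  one_le : 1 ≤ m
  zero_eq_one : b (Sum.inl 0) = 1
  mem_imaginaryUnits : ∀ s : Fin (m + 1), s ≠ 0 → b (Sum.inl s) ∈ imaginaryUnits A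
  anticomm : ∀ s t : Fin (m + 1), s ≠ 0 → t ≠ 0 → s ≠ t →
    b (Sum.inl s) * b (Sum.inl t) = -(b (Sum.inl t) * b (Sum.inl s))

/-- The Euclidean norm on `A` attached to the basis `b`. -/
def basisNorm (b : Module.Basis (Fin (m + 1) ⊕ Fin k) ℝ A) (a : A) : ℝ :=
  √(∑ i, (b.repr a i) ^ 2)

/-- The space `Mⁿ`, identified with `ℝ^{(m+1)n}` through the coordinates `x_{j,s}`. -/
abbrev MSpace (n m : ℕ) : Type := EuclideanSpace ℝ (Fin n × Fin (m + 1))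

/-- The component `x_j = ∑ₛ x_{j,s} vₛ ∈ M` of `x ∈ Mⁿ`. -/
def component (b : Module.Basis (Fin (m + 1) ⊕ Fin k) ℝ A) (x : MSpace n m) (j : Fin n) : A :=
  ∑ s, x (j, s) • b (Sum.inl s)

/-! ### Domains with piecewise smooth boundary -/

/-- `ρ` is a `C¹` defining function of the open set `Ω` near the point `y`. -/
def IsDefiningFunctionAt (Ω : Set (MSpace n m)) (y : MSpace n m) (ρ : MSpace n m → ℝ) : Prop :=
  ContDiffAt ℝ 1 ρ y ∧ ρ y = 0 ∧ fderiv ℝ ρ y ≠ 0 ∧ ∀ᶠ z in 𝓝 y, (z ∈ Ω ↔ ρ z < 0)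

/-- `y` is a smooth boundary point of `Ω`: near `y`, the set `Ω` lies on one side of a `C¹`
hypersurface. -/
def IsSmoothBoundaryPoint (Ω : Set (MSpace n m)) (y : MSpace n m) : Prop :=
  ∃ ρ, IsDefiningFunctionAt Ω y ρ

/-- `v` is the unit exterior normal to `∂Ω` at the smooth boundary point `y`, that is
`v = ∇ρ(y) / |∇ρ(y)|` for a `C¹` defining function `ρ`. -/
def IsExteriorUnitNormal (Ω : Set (MSpace n m)) (y v : MSpace n m) : Prop :=
  ∃ ρ, IsDefiningFunctionAt Ω y ρ ∧ v = ‖gradient ρ y‖⁻¹ • gradient ρ y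

open Classical in
/-- The unit exterior normal `ν(y)`; the value `0` at the exceptional points where it does not
exist is irrelevant, since they will form a null set. -/
def exteriorNormal (Ω : Set (MSpace n m)) (y : MSpace n m) : MSpace n m :=
  if h : ∃ v, IsExteriorUnitNormal Ω y v then h.choose else 0

/-- `D` contains a truncated open cone with vertex `x`. -/
def ContainsConeAt (D : Set (MSpace n m)) (x : MSpace n m) : Prop :=
  ∃ (u : MSpace n m) (θ r : ℝ), 0 < θ ∧ 0 < r ∧
    ∀ t : ℝ, 0 < t → t < r → ∀ w : MSpace n m, ‖w - u‖ < θ → x + t • w ∈ D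

/-- The open set `Ω` of `Mⁿ` has piecewise smooth boundary: `∂Ω` is a finite union of compact
patches (bi-Lipschitz images `φᵢ(Dᵢ)` of compact sets `Dᵢ` of `ℝ^{(m+1)n-1}` with null boundary),
each of which consists of smooth boundary points of `Ω` except along its edge `φᵢ(∂Dᵢ)`;
and `∂Ω` has no cusps: every boundary point is the vertex of a truncated cone in `Ω` and of a
truncated cone in the exterior of `Ω`. -/
structure HasPiecewiseSmoothBoundary (Ω : Set (MSpace n m)) : Prop where
  exists_patches : ∃ (p : ℕ) (D : Fin p → Set (EuclideanSpace ℝ (Fin (n * (m + 1) - 1))))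
      (φ : Fin p → EuclideanSpace ℝ (Fin (n * (m + 1) - 1)) → MSpace n m),
    frontier Ω = ⋃ i, φ i '' D i ∧
    ∀ i, IsCompact (D i) ∧ volume (frontier (D i)) = 0 ∧
      (∃ c C : ℝ, 0 < c ∧ ∀ u ∈ D i, ∀ v ∈ D i,
        c * dist u v ≤ dist (φ i u) (φ i v) ∧ dist (φ i u) (φ i v) ≤ C * dist u v) ∧
      ∀ u ∈ interior (D i), IsSmoothBoundaryPoint Ω (φ i u)
  cone_inside : ∀ x ∈ frontier Ω, ContainsConeAt Ω x
  cone_outside : ∀ x ∈ frontier Ω, ContainsConeAt (closure Ω)ᶜ x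

/-! ### The Bochner-Martinelli integral -/

/-- The surface area `2 π^{N/2} / Γ(N/2)` of the unit sphere of `ℝ^N`. -/
def sphereArea (N : ℕ) : ℝ := 2 * Real.pi ^ ((N : ℝ) / 2) / Real.Gamma ((N : ℝ) / 2)

/-- `K_j(x) = σ_{(m+1)n}⁻¹ x_j^c / |x|^{(m+1)n}`. -/
def kernelComponent (b : Module.Basis (Fin (m + 1) ⊕ Fin k) ℝ A) (j : Fin n) (x : MSpace n m) : A :=
  (1 / (sphereArea (n * (m + 1)) * ‖x‖ ^ (n * (m + 1)))) • star (component b x j)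

/-- The density `∑ⱼ K_j(y - x) (ν_j(y) f(y))` of `K(x,y) ∗ f(y)` with respect to `dS(y)`. -/
def integrand (b : Module.Basis (Fin (m + 1) ⊕ Fin k) ℝ A) (Ω : Set (MSpace n m))
    (f : MSpace n m → A) (x y : MSpace n m) : A :=
  ∑ j, kernelComponent b j (y - x) * (component b (exteriorNormal Ω y) j * f y)

/-- The integral over `Γ` against the surface measure (the `((m+1)n-1)`-dimensional Hausdorff
measure, normalised so as to agree with Lebesgue measure), taken componentwise in the basis. -/
def surfaceIntegral (b : Module.Basis (Fin (m + 1) ⊕ Fin k) ℝ A) (Γ : Set (MSpace n m))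
    (g : MSpace n m → A) : A :=
  ∑ i, (∫ y in Γ, b.repr (g y) i ∂μHE[n * (m + 1) - 1]) • b i

/-- The Bochner-Martinelli type integral `C_Γ[f](x)`, where `Γ = ∂Ω`, for `x` outside `Γ`. -/
def bmIntegral (b : Module.Basis (Fin (m + 1) ⊕ Fin k) ℝ A) (Ω : Set (MSpace n m))
    (f : MSpace n m → A) (x : MSpace n m) : A :=
  surfaceIntegral b (frontier Ω) (integrand b Ω f x)

/-! ### Hölder functions and non-tangential limits -/

/-- The Hölder condition with exponent `α` on `E`. -/
def IsHolderOn (b : Module.Basis (Fin (m + 1) ⊕ Fin k) ℝ A) (α : ℝ) (E : Set (MSpace n m))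
    (f : MSpace n m → A) : Prop :=
  ∃ C : ℝ, ∀ x ∈ E, ∀ x' ∈ E, basisNorm b (f x - f x') ≤ C * ‖x - x'‖ ^ α

/-- The non-tangential approach region of aperture `κ` in `D` at the point `x` of `Γ`. -/
def ntRegion (Γ D : Set (MSpace n m)) (κ : ℝ) (x : MSpace n m) : Set (MSpace n m) :=
  {x' | x' ∈ D ∧ ‖x' - x‖ ≤ κ * Metric.infDist x' Γ}

/-- `L` is the non-tangential limit of `F` at `x ∈ Γ` from `D`: the point `x` can be approached
non-tangentially from `D`, and `F(x') → L` as `x' → x` within every approach region. -/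
def HasNTLimit (b : Module.Basis (Fin (m + 1) ⊕ Fin k) ℝ A) (Γ D : Set (MSpace n m))
    (F : MSpace n m → A) (x : MSpace n m) (L : A) : Prop :=
  (∃ κ : ℝ, x ∈ closure (ntRegion Γ D κ x)) ∧
  ∀ κ : ℝ, Tendsto (fun x' => basisNorm b (F x' - L)) (𝓝[ntRegion Γ D κ x] x) (𝓝 0)

end BochnerMartinelli

end

/-!
# The jump formula for the Bochner-Martinelli type integral

Write `N = n * (m + 1)`, `d = N - 1`, `Γ = ∂Ω` and fix `x ∈ Γ`. Splitting the density as
`f y = (f y - f x) + f x` separates two effects.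

*The Hölder part causes no jump.* On an approach region of aperture `κ` one has
`|y - x| ≤ (1 + |κ|) |y - x'|` for all `y ∈ Γ`, on whichever side of `Γ` the point `x'` lies. The
integrand is therefore dominated by a multiple of `|y - x| ^ (α - d)`, which is integrable because
the surface measure of a ball of radius `r` is `O(r ^ d)` on bi-Lipschitz patches
(`integrable_dist_rpow_neg`). By dominated convergence the limits from `Ω` and from the exterior
agree (`HasLocalGauss.tendsto_boundaryMoment`).

*The constant part is `f x` inside and `0` outside.* The boundary moments
`∫_Γ k_p(y - x') ν_q(y) dS(y)` of the real vector field `k(z) = z / (σ_N |z| ^ N)` form a symmetric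
matrix since `k` is curl-free, and its trace is the flux of `k`, which is `1` for `x' ∈ Ω` and `0`
for `x'` in the exterior. Alternativity makes the products `v_s^c (v_t a)` with `s ≠ t` antisymmetric in
`(s, t)` and those with `s = t` equal to `a`, so that only the trace survives
(`IsHypercomplexBasis.sum_smul_star_mul_mul`).

Both properties of the moments follow from the Gauss formula
`∫_Ω ∂ₑG = ∫_Γ G ⟪ν, e⟫ dS` (`HasLocalGauss.integral_fderiv_eq`), which is applied to `k` after a
modification near its pole that makes it globally `C¹`. The Gauss formula itself is proved without
an area formula for parametrized surfaces:

* Near a smooth boundary point `Ω` lies below the graph of a function with arbitrarily small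
  Lipschitz constant. There the normal derivative is integrated by Fubini and the fundamental theorem of
  calculus, the surface measure of the graph differs from the Lebesgue measure of its projection by
  a factor close to `1`, and tangential derivatives contribute little because translating `Ω` in any
  outward direction enlarges it. This gives the formula for nonnegative `G` of small support, up to
  an error that is an arbitrarily small multiple of `∫_Γ G dS`.
* Since the error is relative, a partition of unity makes the formula exact for functions supported
  away from the edges of the patches.
* The edges form a compact set of vanishing `d`-dimensional measure, and are removed by cutoffs
  whose gradients tend to `0` in `L¹`.
-/

noncomputable section

set_option linter.unusedSectionVars false

namespace BochnerMartinelli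

open Metric Set
open scoped RealInnerProductSpace NNReal

/-! ### Flat boundary points and sliding -/

section FlatBoundary

variable {E : Type*} [NormedAddCommGroup E] [InnerProductSpace ℝ E] [FiniteDimensional ℝ E]
  [MeasurableSpace E] [BorelSpace E]

/-- Inside the ball of radius `R` about `y₀`, the set `Ω` is the sublevel set `{σ < 0}` of a
function vanishing at `y₀` that is a `δ`-Lipschitz perturbation of `⟪ν, ·⟫`, `ν` a unit vector. -/
structure IsFlatNear (Ω : Set E) (y₀ ν : E) (δ R : ℝ) (σ : E → ℝ) : Prop where
  norm_eq_one : ‖ν‖ = 1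
  zero : σ y₀ = 0
  flat : ∀ z ∈ ball y₀ R, ∀ z' ∈ ball y₀ R, |σ z - σ z' - ⟪ν, z - z'⟫| ≤ δ * ‖z - z'‖
  mem_iff : ∀ z ∈ ball y₀ R, (z ∈ Ω ↔ σ z < 0)

lemma hasDerivAt_setIntegral_translate {Ω : Set E} (hΩ : Bornology.IsBounded Ω) {G : E → ℝ}
    (hG : ContDiff ℝ 1 G) (hGc : HasCompactSupport G) (v : E) :
    HasDerivAt (fun τ : ℝ => ∫ z in Ω, G (z + τ • v)) (∫ z in Ω, fderiv ℝ G z v) 0 := by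
  have hfin : IsFiniteMeasure (volume.restrict Ω) :=
    ⟨by rw [Measure.restrict_apply_univ]; exact hΩ.measure_lt_top⟩
  have hd : Continuous (fderiv ℝ G) := hG.continuous_fderiv one_ne_zero
  obtain ⟨C, hC⟩ := (hd.clm_apply continuous_const :
    Continuous fun z => fderiv ℝ G z v).bounded_above_of_compact_support (hGc.fderiv_apply ℝ v)
  obtain ⟨C', hC'⟩ := hG.continuous.bounded_above_of_compact_support hGc
  have key := hasDerivAt_integral_of_dominated_loc_of_deriv_le (𝕜 := ℝ)
    (μ := volume.restrict Ω) (x₀ := (0 : ℝ)) (s := univ) (bound := fun _ => C)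
    (F := fun (τ : ℝ) z => G (z + τ • v)) (F' := fun τ z => fderiv ℝ G (z + τ • v) v)
    univ_mem ?_ ?_ ?_ ?_ (integrable_const _) ?_
  · simpa using key.2
  · exact Eventually.of_forall fun τ =>
      (hG.continuous.comp (continuous_id.add continuous_const)).aestronglyMeasurable
  · refine Integrable.of_bound (C := C')
      (hG.continuous.comp (continuous_id.add continuous_const)).aestronglyMeasurable
      (Eventually.of_forall fun z => hC' _)
  · exact ((hd.clm_apply continuous_const).comp
      (continuous_id.add continuous_const)).aestronglyMeasurable
  · exact Eventually.of_forall fun z τ _ => hC _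
  · refine Eventually.of_forall fun z τ _ => ?_
    have h1 : HasDerivAt (fun τ : ℝ => z + τ • v) v τ := by
      simpa using ((hasDerivAt_id τ).smul_const v).const_add z
    exact ((hG.differentiable one_ne_zero) (z + τ • v)).hasFDerivAt.comp_hasDerivAt τ h1

/-- Sliding `Ω` in an outward direction `v` enlarges it near a flat boundary point, so the
derivative along `v` of a nonnegative function has nonnegative integral over `Ω`. -/
lemma IsFlatNear.setIntegral_fderiv_nonneg {Ω : Set E} {y₀ ν : E} {δ R : ℝ} {σ : E → ℝ}
    (h : IsFlatNear Ω y₀ ν δ R σ) (hΩo : IsOpen Ω) (hΩ : Bornology.IsBounded Ω) {G : E → ℝ}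
    (hG : ContDiff ℝ 1 G) (hGc : HasCompactSupport G) (hGs : tsupport G ⊆ ball y₀ R)
    (hG0 : ∀ z, 0 ≤ G z) {v : E} (hv : δ * ‖v‖ ≤ ⟪ν, v⟫) :
    0 ≤ ∫ z in Ω, fderiv ℝ G z v := by
  have hder := hasDerivAt_setIntegral_translate hΩ hG hGc v
  obtain ⟨η, hη, hηs⟩ := hGc.isCompact.exists_thickening_subset_open isOpen_ball hGs
  have hlim := hder.tendsto_slope_zero_right
  refine ge_of_tendsto hlim ?_
  have hsmall : ∀ᶠ t : ℝ in 𝓝[>] 0, t * ‖v‖ < η := by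
    have : Tendsto (fun t : ℝ => t * ‖v‖) (𝓝[>] 0) (𝓝 (0 * ‖v‖)) :=
      ((continuous_id.mul continuous_const).tendsto 0).mono_left nhdsWithin_le_nhds
    rw [zero_mul] at this
    exact this.eventually (gt_mem_nhds hη)
  filter_upwards [hsmall, self_mem_nhdsWithin] with t ht ht0
  have ht0 : 0 < t := ht0
  refine smul_nonneg (inv_nonneg.2 ht0.le) (sub_nonneg.2 ?_)
  simp only [zero_add, zero_smul, add_zero]
  -- both integrals become integrals of `G`, over the translate `Ω + t • v` and over `Ω`
  have e1 : ∫ z in Ω, G (z + t • v) = ∫ z, Ω.indicator 1 (z - t • v) * G z := by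
    rw [← integral_indicator hΩo.measurableSet,
      ← integral_sub_right_eq_self (fun z => Ω.indicator (fun z => G (z + t • v)) z) (t • v)]
    congr 1; ext z
    by_cases hz : z - t • v ∈ Ω <;> simp [hz]
  have e2 : ∫ z in Ω, G z = ∫ z, Ω.indicator 1 z * G z := by
    rw [← integral_indicator hΩo.measurableSet]
    congr 1; ext z
    by_cases hz : z ∈ Ω <;> simp [hz]
  rw [e1, e2]
  have hGi : Integrable G := hG.continuous.integrable_of_hasCompactSupport hGc
  have hm : Measurable (Ω.indicator (1 : E → ℝ)) := measurable_one.indicator hΩo.measurableSet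
  have hb : ∀ z, ‖Ω.indicator (1 : E → ℝ) z‖ ≤ 1 := fun z => by
    by_cases hz : z ∈ Ω <;> simp [hz]
  refine integral_mono (hGi.bdd_mul (c := 1) hm.aestronglyMeasurable (Eventually.of_forall hb))
    (hGi.bdd_mul (c := 1) (hm.comp (measurable_id.sub_const _)).aestronglyMeasurable
      (Eventually.of_forall fun z => hb _)) ?_
  intro z
  by_cases hGz : G z = 0
  · simp [hGz]
  by_cases hz : z ∈ Ω
  swap
  · simp only [hz, not_false_eq_true, indicator_of_notMem, zero_mul]
    exact mul_nonneg (indicator_nonneg (by simp) _) (hG0 z)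
  have hzs : z ∈ tsupport G := subset_tsupport G hGz
  have hzb : z ∈ ball y₀ R := hGs hzs
  have hzb' : z - t • v ∈ ball y₀ R := by
    refine hηs (mem_thickening_iff.2 ⟨z, hzs, ?_⟩)
    rw [dist_eq_norm]
    simpa [norm_smul, abs_of_pos ht0] using ht
  have hz' : z - t • v ∈ Ω := by
    rw [h.mem_iff _ hzb']
    have h1 := (h.mem_iff _ hzb).1 hz
    have h2 := (abs_le.1 (h.flat _ hzb' _ hzb)).2
    have h3 : z - t • v - z = (-t) • v := by rw [neg_smul]; abel
    rw [h3, inner_smul_right, norm_smul, norm_neg, Real.norm_of_nonneg ht0.le] at h2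
    nlinarith
  simp [hz, hz']

lemma setIntegral_fderiv_lin {Ω : Set E} (hΩ : Bornology.IsBounded Ω) {G : E → ℝ}
    (hG : ContDiff ℝ 1 G) (a c : ℝ) (u v : E) :
    ∫ z in Ω, fderiv ℝ G z (a • u + c • v)
      = a * (∫ z in Ω, fderiv ℝ G z u) + c * ∫ z in Ω, fderiv ℝ G z v := by
  have hi : ∀ w : E, IntegrableOn (fun z => fderiv ℝ G z w) Ω := fun w =>
    (((hG.continuous_fderiv one_ne_zero).clm_apply continuous_const).continuousOn
      |>.integrableOn_compact (hΩ.isCompact_closure)).mono_set subset_closure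
  simp only [map_add, map_smul, smul_eq_mul]
  rw [integral_add ((hi u).const_mul a) ((hi v).const_mul c), integral_const_mul,
    integral_const_mul]

/-- Both `e + cν` and `-e + cν` are outward for `e ⟂ ν` and `c = 2δ‖e‖`. Hence tangential
derivatives contribute at most `2δ` times the normal one. -/
lemma IsFlatNear.abs_setIntegral_fderiv_sub_le {Ω : Set E} {y₀ ν : E} {δ R : ℝ} {σ : E → ℝ}
    (h : IsFlatNear Ω y₀ ν δ R σ) (hδ0 : 0 ≤ δ) (hδ : δ ≤ 1 / 4)
    (hΩo : IsOpen Ω) (hΩ : Bornology.IsBounded Ω) {G : E → ℝ}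
    (hG : ContDiff ℝ 1 G) (hGc : HasCompactSupport G) (hGs : tsupport G ⊆ ball y₀ R)
    (hG0 : ∀ z, 0 ≤ G z) (e : E) :
    |(∫ z in Ω, fderiv ℝ G z e) - ⟪ν, e⟫ * ∫ z in Ω, fderiv ℝ G z ν|
      ≤ 4 * δ * ‖e‖ * ∫ z in Ω, fderiv ℝ G z ν := by
  have hν : ⟪ν, ν⟫ = 1 := by rw [real_inner_self_eq_norm_sq, h.norm_eq_one, one_pow]
  set e' := e - ⟪ν, e⟫ • ν with he'
  have hperp : ⟪ν, e'⟫ = 0 := by rw [he', inner_sub_right, inner_smul_right, hν]; ring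
  have hie : |⟪ν, e⟫| ≤ ‖e‖ := by simpa [h.norm_eq_one] using abs_real_inner_le_norm ν e
  have hne' : ‖e'‖ ≤ 2 * ‖e‖ := by
    calc ‖e'‖ ≤ ‖e‖ + ‖⟪ν, e⟫ • ν‖ := norm_sub_le _ _
      _ ≤ ‖e‖ + ‖e‖ := by
          rw [norm_smul, h.norm_eq_one, mul_one, Real.norm_eq_abs]; gcongr
      _ = 2 * ‖e‖ := by ring
  have hpos : 0 ≤ ∫ z in Ω, fderiv ℝ G z ν :=
    h.setIntegral_fderiv_nonneg hΩo hΩ hG hGc hGs hG0 (by rw [h.norm_eq_one, hν]; linarith)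
  have hout : ∀ s : ℝ, |s| = 1 →
      0 ≤ s * (∫ z in Ω, fderiv ℝ G z e') + (2 * δ * ‖e'‖) * ∫ z in Ω, fderiv ℝ G z ν := by
    intro s hs
    rw [← setIntegral_fderiv_lin hΩ hG]
    refine h.setIntegral_fderiv_nonneg hΩo hΩ hG hGc hGs hG0 ?_
    rw [inner_add_right, inner_smul_right, inner_smul_right, hperp, hν]
    have : ‖s • e' + (2 * δ * ‖e'‖) • ν‖ ≤ ‖e'‖ + 2 * δ * ‖e'‖ := by
      refine (norm_add_le _ _).trans (le_of_eq ?_)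
      rw [norm_smul, norm_smul, h.norm_eq_one, Real.norm_eq_abs, hs,
        Real.norm_of_nonneg (by positivity)]
      ring
    have h0 := norm_nonneg e'
    calc _ ≤ δ * (‖e'‖ + 2 * δ * ‖e'‖) := by gcongr
      _ ≤ δ * (‖e'‖ + 2 * (1 / 2) * ‖e'‖) := by gcongr; linarith
      _ = _ := by ring
  have hp := hout 1 (by simp)
  have hm := hout (-1) (by simp)
  have hsplit : (∫ z in Ω, fderiv ℝ G z e') =
      (∫ z in Ω, fderiv ℝ G z e) - ⟪ν, e⟫ * ∫ z in Ω, fderiv ℝ G z ν := by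
    have := setIntegral_fderiv_lin hΩ hG 1 (-⟪ν, e⟫) e ν
    rw [one_smul, neg_smul, ← sub_eq_add_neg, ← he'] at this
    rw [this]; ring
  rw [← hsplit]
  have hb : 2 * δ * ‖e'‖ * (∫ z in Ω, fderiv ℝ G z ν)
      ≤ 4 * δ * ‖e‖ * ∫ z in Ω, fderiv ℝ G z ν := by
    refine mul_le_mul_of_nonneg_right ?_ hpos
    nlinarith
  rw [abs_le]
  constructor <;> linarith

end FlatBoundary

/-! ### Surface measure of graphs and boundaries as graphs -/

section HausdorffLipschitz

variable {X Y : Type*} [EMetricSpace X] [MeasurableSpace X] [BorelSpace X]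
  [EMetricSpace Y] [MeasurableSpace Y] [BorelSpace Y]

lemma euclideanHausdorffMeasure_image_le {K : ℝ≥0} {f : X → Y} {s : Set X}
    (h : LipschitzOnWith K f s) (d : ℕ) : μHE[d] (f '' s) ≤ (K : ENNReal) ^ d * μHE[d] s := by
  have := h.hausdorffMeasure_image_le (d := d) (Nat.cast_nonneg d)
  rw [ENNReal.rpow_natCast] at this
  simp only [Measure.euclideanHausdorffMeasure_def, Measure.smul_apply, ENNReal.smul_def,
    smul_eq_mul]
  calc _ ≤ _ * ((K : ENNReal) ^ d * μH[d] s) := by gcongr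
    _ = _ := by ring

lemma euclideanHausdorffMeasure_le_image {f : X → Y} (h : AntilipschitzWith 1 f) (s : Set X)
    (d : ℕ) : μHE[d] s ≤ μHE[d] (f '' s) := by
  have := h.le_hausdorffMeasure_image (d := d) (Nat.cast_nonneg d) s
  simp only [ENNReal.coe_one, ENNReal.one_rpow, one_mul] at this
  simp only [Measure.euclideanHausdorffMeasure_def, Measure.smul_apply, ENNReal.smul_def,
    smul_eq_mul]
  gcongr

end HausdorffLipschitz

section Graph

variable {E : Type*} [NormedAddCommGroup E] [InnerProductSpace ℝ E] [FiniteDimensional ℝ E]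
  [MeasurableSpace E] [BorelSpace E]

/-- For a `K`-Lipschitz parametrization that does not decrease distances, such as that of a graph
over its projection, surface measure is comparable to Lebesgue measure on the parameter space. -/
lemma map_volume_restrict_le_euclideanHausdorffMeasure {W : Type*} [NormedAddCommGroup W]
    [InnerProductSpace ℝ W] [FiniteDimensional ℝ W] [MeasurableSpace W] [BorelSpace W] {d : ℕ}
    (hd : Module.finrank ℝ W = d) {T : W → E} {K : ℝ≥0} (hT : LipschitzWith K T)
    (hT' : AntilipschitzWith 1 T) (B : Set W) :
    (volume.restrict B).map T ≤ (μHE[d] : Measure E).restrict (T '' B) ∧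
    (μHE[d] : Measure E).restrict (T '' B) ≤ (K : ENNReal) ^ d • (volume.restrict B).map T := by
  have hemb : MeasurableEmbedding T :=
    (hT'.isClosedEmbedding hT.uniformContinuous).measurableEmbedding
  have hvol : (volume : Measure W) = μHE[d] := by
    rw [← hd, InnerProductSpace.euclideanHausdorffMeasure_eq_volume]
  have hset : ∀ X : Set E, X ∩ T '' B = T '' (T ⁻¹' X ∩ B) := fun X => by
    rw [image_preimage_inter]
  constructor
  · refine Measure.le_iff.2 fun X hX => ?_
    rw [hemb.map_apply, Measure.restrict_apply (hemb.measurable hX), Measure.restrict_apply hX,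
      hset, hvol]
    exact euclideanHausdorffMeasure_le_image hT' _ d
  · refine Measure.le_iff.2 fun X hX => ?_
    rw [Measure.smul_apply, hemb.map_apply, Measure.restrict_apply (hemb.measurable hX),
      Measure.restrict_apply hX, hset, hvol, smul_eq_mul]
    exact euclideanHausdorffMeasure_image_le hT.lipschitzOnWith d

/-- The point of `E` at height `t` over `w ∈ ν^⊥`, in coordinates centred at `y₀`. -/
def normalCoord (y₀ ν : E) (t : ℝ) (w : (Submodule.span ℝ {ν})ᗮ) : E := y₀ + t • ν + (w : E)

lemma measurePreserving_normalCoord (y₀ : E) {ν : E} (hν : ‖ν‖ = 1) :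
    MeasurePreserving (fun p : (Submodule.span ℝ {ν})ᗮ × ℝ => normalCoord y₀ ν p.2 p.1)
      (volume.prod volume) volume := by
  have h1 := ((Submodule.span ℝ {ν}).measurePreserving_measurableEquivProd y₀).symm
  rw [InnerProductSpace.euclideanHausdorffMeasure_eq_volume] at h1
  have h2 := (LinearIsometryEquiv.toSpanUnitSingleton (𝕜 := ℝ) ν hν).measurePreserving.prod
    (MeasurePreserving.id (volume : Measure (Submodule.span ℝ {ν})ᗮ))
  have h3 := (h1.comp h2).comp (Measure.measurePreserving_swap
    (μ := (volume : Measure (Submodule.span ℝ {ν})ᗮ)) (ν := (volume : Measure ℝ)))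
  refine (congrArg (fun F => MeasurePreserving F (volume.prod volume) volume) ?_).mp h3
  funext p
  symm
  change y₀ + p.2 • ν + (p.1 : E) = ((Submodule.span ℝ {ν}).measurableEquivProd y₀).symm
    (LinearIsometryEquiv.toSpanUnitSingleton (𝕜 := ℝ) ν hν p.2, p.1)
  rw [Submodule.measurableEquivProd_symm_apply, vadd_eq_add,
    LinearIsometryEquiv.toSpanUnitSingleton_apply]
  abel

lemma inner_normalCoord_sub (y₀ : E) {ν : E} (hν : ‖ν‖ = 1) (t : ℝ)
    (w : (Submodule.span ℝ {ν})ᗮ) : ⟪ν, normalCoord y₀ ν t w - y₀⟫ = t := by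
  have h : ⟪ν, (w : E)⟫ = 0 := Submodule.mem_orthogonal_singleton_iff_inner_right.1 w.2
  have : normalCoord y₀ ν t w - y₀ = t • ν + w := by simp only [normalCoord]; abel
  rw [this, inner_add_right, inner_smul_right, h, real_inner_self_eq_norm_sq, hν]; ring

lemma normalCoord_sub_normalCoord (y₀ ν : E) (t t' : ℝ) (w w' : (Submodule.span ℝ {ν})ᗮ) :
    normalCoord y₀ ν t w - normalCoord y₀ ν t' w'
      = (t - t') • ν + ((w - w' : (Submodule.span ℝ {ν})ᗮ) : E) := by
  simp only [normalCoord, sub_smul, Submodule.coe_sub]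
  abel

lemma norm_normalCoord_sub_le (y₀ : E) {ν : E} (hν : ‖ν‖ = 1) (t t' : ℝ)
    (w w' : (Submodule.span ℝ {ν})ᗮ) :
    ‖normalCoord y₀ ν t w - normalCoord y₀ ν t' w'‖ ≤ |t - t'| + ‖w - w'‖ := by
  rw [normalCoord_sub_normalCoord]
  refine (norm_add_le _ _).trans ?_
  rw [norm_smul, hν, mul_one, Real.norm_eq_abs, Submodule.coe_norm]

lemma norm_le_norm_normalCoord_sub (y₀ : E) {ν : E} (t t' : ℝ)
    (w w' : (Submodule.span ℝ {ν})ᗮ) :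
    ‖w - w'‖ ≤ ‖normalCoord y₀ ν t w - normalCoord y₀ ν t' w'‖ := by
  rw [normalCoord_sub_normalCoord]
  have h : ⟪ν, ((w - w' : (Submodule.span ℝ {ν})ᗮ) : E)⟫ = 0 :=
    Submodule.mem_orthogonal_singleton_iff_inner_right.1 (w - w').2
  have h2 := norm_add_sq_eq_norm_sq_add_norm_sq_real
    (x := (t - t') • ν) (y := ((w - w' : (Submodule.span ℝ {ν})ᗮ) : E))
    (by rw [inner_smul_left, h, mul_zero])
  rw [Submodule.coe_norm]
  refine le_of_sq_le_sq ?_ (norm_nonneg _)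
  nlinarith [mul_self_nonneg ‖(t - t') • ν‖]

/-- The open cylinder about `y₀` with axis `ν`, of radius and half-height `s`. -/
def cylinder (y₀ ν : E) (s : ℝ) : Set E :=
  {z | ‖z - y₀ - ⟪ν, z - y₀⟫ • ν‖ < s ∧ |⟪ν, z - y₀⟫| < s}

lemma isOpen_cylinder (y₀ ν : E) (s : ℝ) : IsOpen (cylinder y₀ ν s) := by
  have h1 : Continuous fun z : E => ‖z - y₀ - ⟪ν, z - y₀⟫ • ν‖ := by fun_prop
  have h2 : Continuous fun z : E => |⟪ν, z - y₀⟫| := by fun_prop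
  exact (isOpen_lt h1 continuous_const).inter (isOpen_lt h2 continuous_const)

lemma normalCoord_mem_cylinder (y₀ : E) {ν : E} (hν : ‖ν‖ = 1) (s t : ℝ)
    (w : (Submodule.span ℝ {ν})ᗮ) :
    normalCoord y₀ ν t w ∈ cylinder y₀ ν s ↔ ‖w‖ < s ∧ |t| < s := by
  simp only [cylinder, mem_ofPred_eq, inner_normalCoord_sub y₀ hν]
  have : normalCoord y₀ ν t w - y₀ - t • ν = w := by simp only [normalCoord]; abel
  rw [this, Submodule.coe_norm]

lemma exists_normalCoord (y₀ : E) {ν : E} (hν : ‖ν‖ = 1) (z : E) :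
    ∃ t w, normalCoord y₀ ν t w = z := by
  refine ⟨⟪ν, z - y₀⟫, ⟨z - y₀ - ⟪ν, z - y₀⟫ • ν, ?_⟩, ?_⟩
  · rw [Submodule.mem_orthogonal_singleton_iff_inner_right, inner_sub_right, inner_smul_right,
      real_inner_self_eq_norm_sq, hν]
    ring
  · simp only [normalCoord]; abel

lemma normalCoord_mem_ball (y₀ : E) {ν : E} (hν : ‖ν‖ = 1) {R t : ℝ}
    {w : (Submodule.span ℝ {ν})ᗮ} (hw : ‖w‖ < R / 4) (ht : |t| ≤ R / 4) :
    normalCoord y₀ ν t w ∈ ball y₀ R := by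
  have h := norm_normalCoord_sub_le y₀ hν t 0 w 0
  have h0 : normalCoord y₀ ν 0 0 = y₀ := by simp [normalCoord]
  rw [h0, sub_zero, sub_zero] at h
  rw [mem_ball, dist_eq_norm]
  have := norm_nonneg w
  linarith

lemma cylinder_subset_ball (y₀ : E) {ν : E} (hν : ‖ν‖ = 1) (R : ℝ) :
    cylinder y₀ ν (R / 4) ⊆ ball y₀ R := by
  intro z hz
  obtain ⟨t, w, rfl⟩ := exists_normalCoord y₀ hν z
  rw [normalCoord_mem_cylinder y₀ hν] at hz
  exact normalCoord_mem_ball y₀ hν hz.1 hz.2.le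

lemma continuous_normalCoord (y₀ ν : E) :
    Continuous fun p : ℝ × (Submodule.span ℝ {ν})ᗮ => normalCoord y₀ ν p.1 p.2 := by
  unfold normalCoord
  fun_prop

/-- Near a flat boundary point `Ω` is the subgraph of a function on `ν^⊥` with small Lipschitz
constant. -/
lemma IsFlatNear.exists_graph {Ω : Set E} {y₀ ν : E} {δ R : ℝ} {σ : E → ℝ}
    (h : IsFlatNear Ω y₀ ν δ R σ) (hδ0 : 0 ≤ δ) (hδ : δ ≤ 1 / 4) (hR : 0 < R) (hΩo : IsOpen Ω) :
    ∃ g : (Submodule.span ℝ {ν})ᗮ → ℝ, LipschitzWith (2 * δ).toNNReal g ∧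
      ∀ w, ‖w‖ < R / 4 → |g w| < R / 4 ∧ ∀ t, |t| < R / 4 →
        (normalCoord y₀ ν t w ∈ Ω ↔ t < g w) ∧
        (normalCoord y₀ ν t w ∈ frontier Ω ↔ t = g w) := by
  have hν := h.norm_eq_one
  set P := normalCoord y₀ ν with hP
  have hsub : ∀ t t' w w', ‖w‖ < R / 4 → ‖w'‖ < R / 4 → |t| ≤ R / 4 → |t'| ≤ R / 4 →
      |σ (P t w) - σ (P t' w') - (t - t')| ≤ δ * (|t - t'| + ‖w - w'‖) := by
    intro t t' w w' hw hw' ht ht'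
    have h1 := h.flat _ (normalCoord_mem_ball y₀ hν hw ht) _ (normalCoord_mem_ball y₀ hν hw' ht')
    have h2 : ⟪ν, P t w - P t' w'⟫ = t - t' := by
      have := inner_normalCoord_sub y₀ hν t w
      have h' := inner_normalCoord_sub y₀ hν t' w'
      rw [← sub_sub_sub_cancel_right _ _ y₀, inner_sub_right, this, h']
    rw [h2] at h1
    exact h1.trans (mul_le_mul_of_nonneg_left (norm_normalCoord_sub_le y₀ hν t t' w w') hδ0)
  have hmono : ∀ w, ‖w‖ < R / 4 → ∀ t t', |t| ≤ R / 4 → |t'| ≤ R / 4 → t < t' →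
      σ (P t w) < σ (P t' w) := by
    intro w hw t t' ht ht' htt
    have h1 := (abs_le.1 (hsub t' t w w hw hw ht' ht)).1
    rw [sub_self, norm_zero, add_zero, abs_of_pos (sub_pos.2 htt)] at h1
    nlinarith
  have hcont : ∀ w, ‖w‖ < R / 4 → ContinuousOn (fun t => σ (P t w)) (Icc (-(R / 4)) (R / 4)) := by
    intro w hw
    refine LipschitzOnWith.continuousOn (K := 2) (LipschitzOnWith.of_dist_le_mul ?_)
    intro t ht t' ht'
    have h1 := hsub t t' w w hw hw (abs_le.2 ht) (abs_le.2 ht')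
    rw [sub_self, norm_zero, add_zero] at h1
    rw [Real.dist_eq, Real.dist_eq]
    have h2 : |σ (P t w) - σ (P t' w)| ≤ |σ (P t w) - σ (P t' w) - (t - t')| + |t - t'| := by
      simpa using abs_add_le (σ (P t w) - σ (P t' w) - (t - t')) (t - t')
    have := abs_nonneg (t - t')
    simp only [NNReal.coe_ofNat]
    nlinarith
  have h00 : σ (P 0 0) = 0 := by
    have : P 0 0 = y₀ := by simp [hP, normalCoord]
    rw [this, h.zero]
  have hex : ∀ w, ‖w‖ < R / 4 → ∃ t, |t| < R / 4 ∧ σ (P t w) = 0 := by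
    intro w hw
    have hR4 : |R / 4| ≤ R / 4 := by rw [abs_of_pos (by linarith)]
    have hup : 0 < σ (P (R / 4) w) := by
      have h1 := (abs_le.1 (hsub (R / 4) 0 w 0 hw (by simpa using by linarith) hR4
        (by simpa using by linarith))).1
      rw [h00, sub_zero, sub_zero, sub_zero, abs_of_pos (by linarith)] at h1
      nlinarith [norm_nonneg w]
    have hlow : σ (P (-(R / 4)) w) < 0 := by
      have h1 := (abs_le.1 (hsub (-(R / 4)) 0 w 0 hw (by simpa using by linarith)
        (by rwa [abs_neg]) (by simpa using by linarith))).2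
      rw [h00, sub_zero, sub_zero, sub_zero, abs_neg, abs_of_pos (by linarith)] at h1
      nlinarith [norm_nonneg w]
    obtain ⟨t, ht, ht0⟩ := intermediate_value_Ioo (by linarith) (hcont w hw) ⟨hlow, hup⟩
    exact ⟨t, abs_lt.2 ht, ht0⟩
  -- the zero of the increasing function `t ↦ σ (P t w)` is the height of the graph over `w`
  choose! g₀ hg₀ hσg₀ using hex
  have hlip : LipschitzOnWith (2 * δ).toNNReal g₀ {w | ‖w‖ < R / 4} := by
    refine LipschitzOnWith.of_dist_le_mul fun w hw w' hw' => ?_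
    have h1 := hsub (g₀ w) (g₀ w') w w' hw hw' (hg₀ w hw).le (hg₀ w' hw').le
    rw [hσg₀ w hw, hσg₀ w' hw', sub_zero, zero_sub, abs_neg] at h1
    rw [Real.dist_eq, dist_eq_norm, Real.coe_toNNReal _ (by linarith)]
    have := abs_nonneg (g₀ w - g₀ w')
    have := norm_nonneg (w - w')
    nlinarith
  obtain ⟨g, hg, hgg⟩ := hlip.extend_real
  refine ⟨g, hg, fun w hw => ?_⟩
  rw [← hgg hw]
  refine ⟨hg₀ w hw, fun t ht => ?_⟩
  have hmem : ∀ t, |t| < R / 4 → (P t w ∈ Ω ↔ t < g₀ w) := by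
    intro t ht
    rw [h.mem_iff _ (normalCoord_mem_ball y₀ hν hw ht.le)]
    constructor
    · intro hs
      by_contra hc
      rcases (not_lt.1 hc).eq_or_lt with he | hlt
      · rw [← he, hσg₀ w hw] at hs; exact lt_irrefl _ hs
      · have := hmono w hw _ _ (hg₀ w hw).le ht.le hlt
        rw [hσg₀ w hw] at this; linarith
    · intro hlt
      have := hmono w hw _ _ ht.le (hg₀ w hw).le hlt
      rwa [hσg₀ w hw] at this
  refine ⟨hmem t ht, ?_⟩
  rw [hΩo.frontier_eq, Set.mem_sdiff, hmem t ht, not_lt]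
  have hPc : Continuous fun t => P t w :=
    (continuous_normalCoord y₀ ν).comp (Continuous.prodMk_left w)
  constructor
  · rintro ⟨hcl, hle⟩
    refine hle.antisymm' (not_lt.1 fun hlt => ?_)
    -- above the graph `σ` is positive, so a neighbourhood misses `Ω`
    have hpos : 0 < σ (P t w) := by
      have := hmono w hw _ _ (hg₀ w hw).le ht.le hlt
      rwa [hσg₀ w hw] at this
    have hb := normalCoord_mem_ball y₀ hν hw ht.le
    have hσc : ContinuousAt σ (P t w) := by
      refine (LipschitzOnWith.continuousOn (K := 2) (s := ball y₀ R)
        (LipschitzOnWith.of_dist_le_mul ?_)).continuousAt (isOpen_ball.mem_nhds hb)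
      intro z hz z' hz'
      have h1 := h.flat z hz z' hz'
      have h2 : |⟪ν, z - z'⟫| ≤ ‖z - z'‖ := by
        simpa [hν] using abs_real_inner_le_norm ν (z - z')
      have h3 : |σ z - σ z'| ≤ |σ z - σ z' - ⟪ν, z - z'⟫| + |⟪ν, z - z'⟫| := by
        simpa using abs_add_le (σ z - σ z' - ⟪ν, z - z'⟫) ⟪ν, z - z'⟫
      rw [Real.dist_eq, dist_eq_norm]
      have := norm_nonneg (z - z')
      simp only [NNReal.coe_ofNat]
      nlinarith
    have hev : ∀ᶠ z in 𝓝 (P t w), z ∉ Ω := by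
      filter_upwards [hσc.eventually (lt_mem_nhds hpos), isOpen_ball.mem_nhds hb] with z hz hzb
      rw [h.mem_iff z hzb]; exact not_lt.2 hz.le
    obtain ⟨z, hz, hz'⟩ := (mem_closure_iff_frequently.1 hcl).and_eventually hev |>.exists
    exact hz' hz
  · rintro rfl
    refine ⟨?_, le_rfl⟩
    have : Tendsto (fun t => P t w) (𝓝[<] (g₀ w)) (𝓝 (P (g₀ w) w)) :=
      (hPc.tendsto _).mono_left nhdsWithin_le_nhds
    refine mem_closure_of_tendsto this ?_
    have habs : ∀ᶠ t in 𝓝[<] (g₀ w), |t| < R / 4 :=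
      (continuous_abs.tendsto _).mono_left nhdsWithin_le_nhds |>.eventually
        (gt_mem_nhds ht)
    filter_upwards [habs, self_mem_nhdsWithin] with t h1 h2
    exact (hmem t h1).2 h2

end Graph

/-! ### The Gauss formula near a smooth boundary point, up to a small error -/

section LocalGauss

variable {E : Type*} [NormedAddCommGroup E] [InnerProductSpace ℝ E] [FiniteDimensional ℝ E]
  [MeasurableSpace E] [BorelSpace E]

/-- Fubini along the lines parallel to the normal, and the fundamental theorem of calculus on each
of them. -/
lemma setIntegral_fderiv_normal_eq {Ω : Set E} (hΩo : IsOpen Ω) {y₀ ν : E} (hν : ‖ν‖ = 1) {s : ℝ}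
    {g : (Submodule.span ℝ {ν})ᗮ → ℝ}
    (hg : ∀ w, ‖w‖ < s → ∀ t, |t| < s → (normalCoord y₀ ν t w ∈ Ω ↔ t < g w)) {G : E → ℝ}
    (hG : ContDiff ℝ 1 G) (hGc : HasCompactSupport G) (hGs : tsupport G ⊆ cylinder y₀ ν s) :
    ∫ z in Ω, fderiv ℝ G z ν = ∫ w in ball 0 s, G (normalCoord y₀ ν (g w) w) := by
  have hd : Continuous (fun z => fderiv ℝ G z ν) :=
    (hG.continuous_fderiv one_ne_zero).clm_apply continuous_const
  have hdi : Integrable (fun z => fderiv ℝ G z ν) :=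
    hd.integrable_of_hasCompactSupport (hGc.fderiv_apply ℝ ν)
  have hmp := measurePreserving_normalCoord y₀ hν
  have hout : ∀ t w, ¬ (‖w‖ < s ∧ |t| < s) → normalCoord y₀ ν t w ∉ tsupport G :=
    fun t w h hc => h ((normalCoord_mem_cylinder y₀ hν s t w).1 (hGs hc))
  have hout' : ∀ t w, ¬ (‖w‖ < s ∧ |t| < s) → fderiv ℝ G (normalCoord y₀ ν t w) ν = 0 := by
    intro t w h
    have : fderiv ℝ G (normalCoord y₀ ν t w) = 0 := by
      by_contra hne
      exact hout t w h (support_fderiv_subset ℝ hne)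
    rw [this]; rfl
  rw [← integral_indicator hΩo.measurableSet]
  have hii : Integrable (Ω.indicator fun z => fderiv ℝ G z ν) := hdi.indicator hΩo.measurableSet
  have hip : Integrable (fun p : (Submodule.span ℝ {ν})ᗮ × ℝ =>
      Ω.indicator (fun z => fderiv ℝ G z ν) (normalCoord y₀ ν p.2 p.1)) (volume.prod volume) :=
    (hmp.integrable_comp hii.aestronglyMeasurable).2 hii
  have hmeas := hii.aestronglyMeasurable
  rw [← hmp.map_eq] at hmeas ⊢
  rw [integral_map hmp.measurable.aemeasurable hmeas, integral_prod _ hip,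
    ← integral_indicator measurableSet_ball]
  congr 1
  ext w
  by_cases hw : ‖w‖ < s
  swap
  · rw [indicator_of_notMem (by simpa using hw)]
    refine (integral_congr_ae (Eventually.of_forall fun t => ?_)).trans (integral_zero ℝ ℝ)
    have : fderiv ℝ G (normalCoord y₀ ν t w) ν = 0 := hout' t w fun h => hw h.1
    by_cases hz : normalCoord y₀ ν t w ∈ Ω <;> simp [hz, this]
  rw [indicator_of_mem (by simpa using hw)]
  have hline : ∀ t, HasDerivAt (fun t => normalCoord y₀ ν t w) ν t := by
    intro t
    unfold normalCoord
    simpa using (((hasDerivAt_id t).smul_const ν).const_add y₀).add_const (w : E)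
  have hder : ∀ t, HasDerivAt (fun t => G (normalCoord y₀ ν t w))
      (fderiv ℝ G (normalCoord y₀ ν t w) ν) t := fun t =>
    (hG.differentiable one_ne_zero _).hasFDerivAt.comp_hasDerivAt t (hline t)
  have hCD : ContDiff ℝ 1 (fun t => G (normalCoord y₀ ν t w)) := by
    refine hG.comp ?_
    unfold normalCoord
    fun_prop
  have hcs : HasCompactSupport (fun t => G (normalCoord y₀ ν t w)) := by
    refine HasCompactSupport.intro (isCompact_Icc (a := -s) (b := s)) fun t ht => ?_
    by_contra hne
    refine hout t w (fun h => ht (abs_le.1 h.2.le)) (subset_tsupport G hne)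
  rw [← hcs.integral_Iic_deriv_eq hCD (g w), integral_Iic_eq_integral_Iio,
    ← integral_indicator measurableSet_Iio]
  congr 1
  ext t
  by_cases ht : |t| < s
  · have hiff := hg w hw t ht
    by_cases hlt : t < g w
    · rw [indicator_of_mem (hiff.2 hlt), indicator_of_mem (mem_Iio.2 hlt), (hder t).deriv]
    · rw [indicator_of_notMem (mt hiff.1 hlt), indicator_of_notMem (mt mem_Iio.1 hlt)]
  · have h0 : fderiv ℝ G (normalCoord y₀ ν t w) ν = 0 := hout' t w fun h => ht h.2
    have h1 : deriv (fun t => G (normalCoord y₀ ν t w)) t = 0 := (hder t).deriv.trans h0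
    exact ((indicator_apply_eq_zero (f := fun z => fderiv ℝ G z ν)).2 fun _ => h0).trans
      (indicator_apply_eq_zero.2 fun _ => h1).symm

/-- Up to a factor that tends to `1` with the slope of the graph, the integral over a graph with
respect to the surface measure is the integral over the parameter domain. -/
lemma setIntegral_graph_bounds {d : ℕ} (hd : Module.finrank ℝ E = d + 1) {Ω : Set E} {y₀ ν : E}
    (hν : ‖ν‖ = 1) {s : ℝ} {L : ℝ≥0} {g : (Submodule.span ℝ {ν})ᗮ → ℝ} (hgL : LipschitzWith L g)
    (hg : ∀ w, ‖w‖ < s → |g w| < s ∧ ∀ t, |t| < s →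
      (normalCoord y₀ ν t w ∈ frontier Ω ↔ t = g w)) {G : E → ℝ}
    (hG : Continuous G) (hGc : HasCompactSupport G) (hGs : tsupport G ⊆ cylinder y₀ ν s)
    (hG0 : ∀ z, 0 ≤ G z) :
    (∫ w in ball 0 s, G (normalCoord y₀ ν (g w) w)) ≤ ∫ y in frontier Ω, G y ∂μHE[d] ∧
    (∫ y in frontier Ω, G y ∂μHE[d]) ≤
      (1 + L : ℝ) ^ d * ∫ w in ball 0 s, G (normalCoord y₀ ν (g w) w) := by
  set T : (Submodule.span ℝ {ν})ᗮ → E := fun w => normalCoord y₀ ν (g w) w with hT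
  have hTl : LipschitzWith (1 + L) T := by
    refine LipschitzWith.of_dist_le_mul fun w w' => ?_
    rw [dist_eq_norm, dist_eq_norm]
    refine (norm_normalCoord_sub_le y₀ hν _ _ _ _).trans ?_
    have := hgL.dist_le_mul w w'
    rw [Real.dist_eq, dist_eq_norm] at this
    push_cast
    linarith
  have hTa : AntilipschitzWith 1 T := by
    refine AntilipschitzWith.of_le_mul_dist fun w w' => ?_
    rw [dist_eq_norm, dist_eq_norm, NNReal.coe_one, one_mul]
    exact norm_le_norm_normalCoord_sub y₀ _ _ _ _
  have hfr : Module.finrank ℝ (Submodule.span ℝ {ν})ᗮ = d := by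
    have : Fact (Module.finrank ℝ E = d + 1) := ⟨hd⟩
    exact Submodule.finrank_orthogonal_span_singleton (by rintro rfl; simp at hν)
  obtain ⟨hle, hge⟩ := map_volume_restrict_le_euclideanHausdorffMeasure hfr hTl hTa (ball 0 s)
  have hemb : MeasurableEmbedding T :=
    (hTa.isClosedEmbedding hTl.uniformContinuous).measurableEmbedding
  have himg : frontier Ω ∩ cylinder y₀ ν s = T '' ball 0 s := by
    ext z
    obtain ⟨t, w, rfl⟩ := exists_normalCoord y₀ hν z
    rw [mem_inter_iff, normalCoord_mem_cylinder y₀ hν]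
    constructor
    · rintro ⟨hf, hw, ht⟩
      refine ⟨w, by simpa using hw, ?_⟩
      rw [((hg w hw).2 t ht).1 hf]
    · rintro ⟨w', hw', he⟩
      have hw' : ‖w'‖ < s := by simpa using hw'
      have h1 := normalCoord_mem_cylinder y₀ hν s t w
      rw [← he] at h1 ⊢
      have h2 := (normalCoord_mem_cylinder y₀ hν s (g w') w').2 ⟨hw', (hg w' hw').1⟩
      exact ⟨((hg w' hw').2 _ (hg w' hw').1).2 rfl, h1.1 h2⟩
  have hΓ : ∫ y in frontier Ω, G y ∂μHE[d] = ∫ y in T '' ball 0 s, G y ∂μHE[d] := by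
    rw [← himg]
    refine setIntegral_eq_of_subset_of_forall_sdiff_eq_zero
      (isClosed_frontier (s := Ω)).measurableSet inter_subset_left ?_
    rintro y ⟨hy1, hy2⟩
    by_contra hne
    exact hy2 ⟨hy1, hGs (subset_tsupport G hne)⟩
  have hmap : ∫ w in ball 0 s, G (T w) = ∫ y, G y ∂((volume.restrict (ball 0 s)).map T) :=
    (hemb.integral_map _).symm
  have hfin : IsFiniteMeasure ((volume.restrict (ball (0 : (Submodule.span ℝ {ν})ᗮ) s)).map T) := by
    have : IsFiniteMeasure (volume.restrict (ball (0 : (Submodule.span ℝ {ν})ᗮ) s)) :=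
      ⟨by rw [Measure.restrict_apply_univ]; exact measure_ball_lt_top⟩
    infer_instance
  have hKt : ((1 + L : ℝ≥0) : ENNReal) ^ d ≠ ⊤ := ENNReal.pow_ne_top ENNReal.coe_ne_top
  obtain ⟨C, hC⟩ := hG.bounded_above_of_compact_support hGc
  have hi1 : Integrable G (((1 + L : ℝ≥0) : ENNReal) ^ d •
      (volume.restrict (ball 0 s)).map T) :=
    (Integrable.of_bound hG.aestronglyMeasurable C (Eventually.of_forall hC)).smul_measure hKt
  have h0 : ∀ μ : Measure E, 0 ≤ᵐ[μ] G := fun μ => Eventually.of_forall hG0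
  change (∫ w in ball 0 s, G (T w)) ≤ _ ∧ _ ≤ _ * ∫ w in ball 0 s, G (T w)
  rw [hΓ, hmap]
  refine ⟨integral_mono_measure hle (h0 _) (hi1.mono_measure hge), ?_⟩
  have h3 := integral_mono_measure hge (h0 _) hi1
  rw [integral_smul_measure, smul_eq_mul] at h3
  rwa [ENNReal.toReal_pow, ENNReal.coe_toReal, NNReal.coe_add, NNReal.coe_one] at h3

/-- The Gauss formula near a flat boundary point, up to an error that is small relative to the
surface integral. -/
lemma IsFlatNear.abs_gauss_sub_le {d : ℕ} (hd : Module.finrank ℝ E = d + 1) {Ω : Set E}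
    {y₀ ν : E} {δ R : ℝ} {σ : E → ℝ} (h : IsFlatNear Ω y₀ ν δ R σ) (hδ0 : 0 ≤ δ)
    (hδ : δ ≤ 1 / 4) (hR : 0 < R) (hΩo : IsOpen Ω) (hΩ : Bornology.IsBounded Ω)
    (hfin : μHE[d] (frontier Ω) < ⊤) {n : E → E}
    (hn : AEStronglyMeasurable n (μHE[d].restrict (frontier Ω))) (hn1 : ∀ y, ‖n y‖ ≤ 1)
    (hnν : ∀ y ∈ frontier Ω, y ∈ ball y₀ R → ‖n y - ν‖ ≤ δ) {G : E → ℝ}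
    (hG : ContDiff ℝ 1 G) (hGc : HasCompactSupport G)
    (hGs : tsupport G ⊆ cylinder y₀ ν (R / 4)) (hG0 : ∀ z, 0 ≤ G z) (e : E) :
    |(∫ z in Ω, fderiv ℝ G z e) - ∫ y in frontier Ω, G y * ⟪n y, e⟫ ∂μHE[d]|
      ≤ (5 * δ + ((1 + 2 * δ) ^ d - 1)) * ‖e‖ * ∫ y in frontier Ω, G y ∂μHE[d] := by
  obtain ⟨g, hgL, hg⟩ := h.exists_graph hδ0 hδ hR hΩo
  have hν := h.norm_eq_one
  have hsub := cylinder_subset_ball y₀ hν R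
  have hA := setIntegral_fderiv_normal_eq hΩo hν (fun w hw t ht => ((hg w hw).2 t ht).1) hG hGc hGs
  obtain ⟨hAB, hBA⟩ := setIntegral_graph_bounds hd hν hgL
    (fun w hw => ⟨(hg w hw).1, fun t ht => ((hg w hw).2 t ht).2⟩) hG.continuous hGc hGs hG0
  have h1 := h.abs_setIntegral_fderiv_sub_le hδ0 hδ hΩo hΩ hG hGc (hGs.trans hsub) hG0 e
  rw [← hA] at hAB hBA
  rw [Real.coe_toNNReal _ (by linarith)] at hBA
  set A := ∫ z in Ω, fderiv ℝ G z ν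
  set B := ∫ y in frontier Ω, G y ∂μHE[d] with hB
  have hfin' : IsFiniteMeasure ((μHE[d] : Measure E).restrict (frontier Ω)) :=
    ⟨by rwa [Measure.restrict_apply_univ]⟩
  obtain ⟨C, hC⟩ := hG.continuous.bounded_above_of_compact_support hGc
  have hGi : Integrable G ((μHE[d] : Measure E).restrict (frontier Ω)) :=
    Integrable.of_bound hG.continuous.aestronglyMeasurable C (Eventually.of_forall hC)
  have hGn : Integrable (fun y => G y * ⟪n y, e⟫) ((μHE[d] : Measure E).restrict (frontier Ω)) := by
    refine hGi.mul_bdd (c := ‖e‖) (hn.inner aestronglyMeasurable_const)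
      (Eventually.of_forall fun y => ?_)
    refine (norm_inner_le_norm _ _).trans ?_
    exact mul_le_of_le_one_left (norm_nonneg e) (hn1 y)
  have h3 : |⟪ν, e⟫ * B - ∫ y in frontier Ω, G y * ⟪n y, e⟫ ∂μHE[d]| ≤ δ * ‖e‖ * B := by
    rw [hB, ← integral_const_mul, ← integral_sub (hGi.const_mul _) hGn, ← integral_const_mul,
      ← Real.norm_eq_abs]
    refine norm_integral_le_of_norm_le (hGi.const_mul _) ?_
    refine (ae_restrict_iff' isClosed_frontier.measurableSet).2 (Eventually.of_forall fun y hy => ?_)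
    by_cases hy0 : G y = 0
    · simp [hy0]
    have hyb : y ∈ ball y₀ R := hsub (hGs (subset_tsupport G hy0))
    have : ⟪ν, e⟫ * G y - G y * ⟪n y, e⟫ = - (G y * ⟪n y - ν, e⟫) := by
      rw [inner_sub_left]; ring
    rw [this, norm_neg, norm_mul, Real.norm_of_nonneg (hG0 y), mul_comm]
    refine mul_le_mul_of_nonneg_right ?_ (hG0 y)
    exact (norm_inner_le_norm _ _).trans
      (mul_le_mul_of_nonneg_right (hnν y hy hyb) (norm_nonneg e))
  have hie : |⟪ν, e⟫| ≤ ‖e‖ := by simpa [hν] using abs_real_inner_le_norm ν e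
  have hK : 1 ≤ (1 + 2 * δ) ^ d := one_le_pow₀ (by linarith)
  have h2 : |⟪ν, e⟫ * A - ⟪ν, e⟫ * B| ≤ ‖e‖ * (((1 + 2 * δ) ^ d - 1) * B) := by
    rw [← mul_sub, abs_mul, abs_sub_comm, abs_of_nonneg (sub_nonneg.2 hAB)]
    refine mul_le_mul hie ?_ (sub_nonneg.2 hAB) (norm_nonneg e)
    nlinarith
  have h4 : 4 * δ * ‖e‖ * A ≤ 4 * δ * ‖e‖ * B := by gcongr
  rw [abs_le] at h1 h2 h3 ⊢
  constructor <;> linarith [h1.1, h1.2, h2.1, h2.2, h3.1, h3.2]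

/-- A `C¹` defining function makes the boundary flat to any prescribed accuracy. -/
lemma exists_isFlatNear {Ω : Set E} {y₀ : E} {ρ : E → ℝ} (hρ : ContDiffAt ℝ 1 ρ y₀)
    (hρ0 : ρ y₀ = 0) (hρ' : gradient ρ y₀ ≠ 0) (hρΩ : ∀ᶠ z in 𝓝 y₀, (z ∈ Ω ↔ ρ z < 0))
    {n : E → E}
    (hn : ∀ᶠ y in 𝓝 y₀, y ∈ frontier Ω → n y = ‖gradient ρ y‖⁻¹ • gradient ρ y)
    {δ : ℝ} (hδ : 0 < δ) :
    ∃ R > 0, ∃ σ, IsFlatNear Ω y₀ (‖gradient ρ y₀‖⁻¹ • gradient ρ y₀) δ R σ ∧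
      ∀ y ∈ frontier Ω, y ∈ ball y₀ R →
        ‖n y - ‖gradient ρ y₀‖⁻¹ • gradient ρ y₀‖ ≤ δ := by
  set a := ‖gradient ρ y₀‖ with ha
  have ha0 : 0 < a := norm_pos_iff.2 hρ'
  have hstr := (hρ.hasStrictFDerivAt one_ne_zero).isLittleO.def (mul_pos hδ ha0)
  rw [nhds_prod_eq] at hstr
  obtain ⟨p, hp, q, hq, hpq⟩ := eventually_prod_iff.1 hstr
  have hgc : ContinuousAt (gradient ρ) y₀ := by
    have h1 : ContinuousAt (fderiv ℝ ρ) y₀ := hρ.continuousAt_fderiv one_ne_zero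
    exact (InnerProductSpace.toDual ℝ E).symm.continuous.continuousAt.comp h1
  have hnc : ContinuousAt (fun y => ‖gradient ρ y‖⁻¹ • gradient ρ y) y₀ :=
    (hgc.norm.inv₀ (norm_ne_zero_iff.2 hρ')).smul hgc
  have hnear := Metric.continuousAt_iff'.1 hnc δ hδ
  obtain ⟨R, hR, hRs⟩ := Metric.eventually_nhds_iff_ball.1
    (hp.and (hq.and (hρΩ.and (hn.and hnear))))
  refine ⟨R, hR, fun z => ρ z / a, ⟨?_, by simp [hρ0], ?_, ?_⟩, ?_⟩
  · rw [norm_smul, norm_inv, norm_norm, ← ha, inv_mul_cancel₀ ha0.ne']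
  · intro z hz z' hz'
    have h1 := hpq (hRs z hz).1 (hRs z' hz').2.1
    simp only at h1
    have h2 : fderiv ℝ ρ y₀ (z - z') = ⟪gradient ρ y₀, z - z'⟫ := by
      rw [gradient, InnerProductSpace.toDual_symm_apply]
    rw [h2, Real.norm_eq_abs] at h1
    rw [real_inner_smul_left]
    have h3 : ρ z / a - ρ z' / a - a⁻¹ * ⟪gradient ρ y₀, z - z'⟫
        = (ρ z - ρ z' - ⟪gradient ρ y₀, z - z'⟫) / a := by field_simp
    rw [h3, abs_div, abs_of_pos ha0, div_le_iff₀ ha0]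
    linarith
  · intro z hz
    rw [(hRs z hz).2.2.1]
    constructor
    · intro h; exact div_neg_of_neg_of_pos h ha0
    · intro h; by_contra hc; exact absurd h (not_lt.2 (div_nonneg (not_lt.1 hc) ha0.le))
  · intro y hy hyb
    have h1 := (hRs y hyb).2.2.2
    rw [h1.1 hy, ← dist_eq_norm]
    exact h1.2.le

/-- The property of an open set `U` that the Gauss formula holds up to a relative error `ε` for
nonnegative functions supported in `U`. -/
def GaussUpTo (d : ℕ) (Ω : Set E) (n : E → E) (ε : ℝ) (U : Set E) : Prop :=
  ∀ G : E → ℝ, ContDiff ℝ 1 G → HasCompactSupport G → tsupport G ⊆ U → (∀ z, 0 ≤ G z) →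
    ∀ e : E, |(∫ z in Ω, fderiv ℝ G z e) - ∫ y in frontier Ω, G y * ⟪n y, e⟫ ∂μHE[d]|
      ≤ ε * ‖e‖ * ∫ y in frontier Ω, G y ∂μHE[d]

/-- Near a smooth boundary point the Gauss formula holds up to any prescribed relative error. -/
lemma exists_gaussUpTo {d : ℕ} (hd : Module.finrank ℝ E = d + 1) {Ω : Set E}
    (hΩo : IsOpen Ω) (hΩ : Bornology.IsBounded Ω)
    (hfin : μHE[d] (frontier Ω) < ⊤) {n : E → E}
    (hn : AEStronglyMeasurable n (μHE[d].restrict (frontier Ω))) (hn1 : ∀ y, ‖n y‖ ≤ 1)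
    {y₀ : E} {ρ : E → ℝ} (hρ : ContDiffAt ℝ 1 ρ y₀)
    (hρ0 : ρ y₀ = 0) (hρ' : gradient ρ y₀ ≠ 0) (hρΩ : ∀ᶠ z in 𝓝 y₀, (z ∈ Ω ↔ ρ z < 0))
    (hnρ : ∀ᶠ y in 𝓝 y₀, y ∈ frontier Ω → n y = ‖gradient ρ y‖⁻¹ • gradient ρ y)
    {ε : ℝ} (hε : 0 < ε) : ∃ U, IsOpen U ∧ y₀ ∈ U ∧ GaussUpTo d Ω n ε U := by
  obtain ⟨δ, hδ0, hδ, hδε⟩ : ∃ δ > 0, δ ≤ 1 / 4 ∧ 5 * δ + ((1 + 2 * δ) ^ d - 1) ≤ ε := by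
    have hc : Tendsto (fun δ : ℝ => 5 * δ + ((1 + 2 * δ) ^ d - 1)) (𝓝[>] 0) (𝓝 0) := by
      have : Continuous (fun δ : ℝ => 5 * δ + ((1 + 2 * δ) ^ d - 1)) := by fun_prop
      simpa using (this.tendsto 0).mono_left (nhdsWithin_le_nhds (s := Ioi 0))
    have h4 : ∀ᶠ δ : ℝ in 𝓝[>] 0, δ < 1 / 4 :=
      mem_nhdsWithin_of_mem_nhds (gt_mem_nhds (by norm_num))
    obtain ⟨δ, h1, h2, h3⟩ := ((hc.eventually (gt_mem_nhds hε)).and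
      (h4.and self_mem_nhdsWithin)).exists
    exact ⟨δ, h3, h2.le, h1.le⟩
  obtain ⟨R, hR, σ, hflat, hnν⟩ := exists_isFlatNear hρ hρ0 hρ' hρΩ hnρ hδ0
  refine ⟨cylinder y₀ (‖gradient ρ y₀‖⁻¹ • gradient ρ y₀) (R / 4), isOpen_cylinder _ _ _,
    by simp [cylinder, hR], ?_⟩
  intro G hG hGc hGs hG0 e
  refine (hflat.abs_gauss_sub_le hd hδ0.le hδ hR hΩo hΩ hfin hn hn1 hnν hG hGc hGs hG0 e).trans ?_
  have : 0 ≤ ∫ y in frontier Ω, G y ∂μHE[d] := integral_nonneg hG0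
  gcongr

end LocalGauss

/-! ### Localization of the Gauss formula -/

section GlobalGauss

open scoped Manifold ContDiff

variable {E : Type*} [NormedAddCommGroup E] [InnerProductSpace ℝ E] [FiniteDimensional ℝ E]
  [MeasurableSpace E] [BorelSpace E]

lemma integral_fderiv_eq_zero_of_hasCompactSupport {G : E → ℝ} (hG : ContDiff ℝ 1 G)
    (hGc : HasCompactSupport G) (e : E) : ∫ z, fderiv ℝ G z e = 0 := by
  have hi : Integrable (fun z => fderiv ℝ G z e) :=
    ((hG.continuous_fderiv one_ne_zero).clm_apply continuous_const).integrable_of_hasCompactSupport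
      (hGc.fderiv_apply ℝ e)
  have := integral_mul_fderiv_eq_neg_fderiv_mul_of_integrable (μ := (volume : Measure E))
    (f := fun _ : E => (1 : ℝ)) (g := G) (v := e) (by simp) (by simpa using hi)
    (by simpa using hG.continuous.integrable_of_hasCompactSupport hGc)
    (fun x _ => differentiableAt_const _) (fun x _ => hG.differentiable one_ne_zero x)
  simpa using this

/-- A bounded open set whose boundary has finite surface measure, together with a measurable field
`n` of vectors of norm at most one (the exterior normal, in the application), such that away from a
compact null set `E₀ ⊆ ∂Ω` the Gauss formula holds locally up to arbitrarily small relative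
errors. -/
structure HasLocalGauss (d : ℕ) (Ω : Set E) (n : E → E) (E₀ : Set E) : Prop where
  isOpen : IsOpen Ω
  isBounded : Bornology.IsBounded Ω
  measure_lt_top : μHE[d] (frontier Ω) < ⊤
  aestronglyMeasurable : AEStronglyMeasurable n (μHE[d].restrict (frontier Ω))
  norm_le_one : ∀ y, ‖n y‖ ≤ 1
  isCompact : IsCompact E₀
  measure_zero : μHE[d] E₀ = 0
  subset : E₀ ⊆ frontier Ω
  gauss : ∀ y ∈ frontier Ω, y ∉ E₀ → ∀ ε > 0, ∃ U, IsOpen U ∧ y ∈ U ∧ GaussUpTo d Ω n ε U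

lemma gaussUpTo_self {d : ℕ} {Ω : Set E} (hΩ : IsOpen Ω) (n : E → E) {ε : ℝ} (hε : 0 ≤ ε) :
    GaussUpTo d Ω n ε Ω := by
  intro G hG hGc hGs hG0 e
  have h1 : ∫ z in Ω, fderiv ℝ G z e = 0 := by
    rw [setIntegral_eq_integral_of_forall_compl_eq_zero,
      integral_fderiv_eq_zero_of_hasCompactSupport hG hGc]
    intro z hz
    have : fderiv ℝ G z = 0 := by
      by_contra hne
      exact hz (hGs (support_fderiv_subset ℝ hne))
    rw [this]; rfl
  have h2 : ∫ y in frontier Ω, G y * ⟪n y, e⟫ ∂μHE[d] = 0 := by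
    refine setIntegral_eq_zero_of_forall_eq_zero fun y hy => ?_
    have : G y = 0 := by
      by_contra hne
      have hyΩ := hGs (subset_tsupport G hne)
      rw [hΩ.frontier_eq] at hy
      exact hy.2 hyΩ
    rw [this, zero_mul]
  rw [h1, h2, sub_zero, abs_zero]
  have : 0 ≤ ∫ y in frontier Ω, G y ∂μHE[d] := integral_nonneg hG0
  positivity

lemma gaussUpTo_compl_closure {d : ℕ} (Ω : Set E) (n : E → E) {ε : ℝ} (hε : 0 ≤ ε) :
    GaussUpTo d Ω n ε (closure Ω)ᶜ := by
  intro G hG hGc hGs hG0 e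
  have h1 : ∫ z in Ω, fderiv ℝ G z e = 0 := by
    refine setIntegral_eq_zero_of_forall_eq_zero fun z hz => ?_
    have : fderiv ℝ G z = 0 := by
      by_contra hne
      exact hGs (support_fderiv_subset ℝ hne) (subset_closure hz)
    rw [this]; rfl
  have h2 : ∫ y in frontier Ω, G y * ⟪n y, e⟫ ∂μHE[d] = 0 := by
    refine setIntegral_eq_zero_of_forall_eq_zero fun y hy => ?_
    have : G y = 0 := by
      by_contra hne
      exact hGs (subset_tsupport G hne) (frontier_subset_closure hy)
    rw [this, zero_mul]
  rw [h1, h2, sub_zero, abs_zero]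
  have : 0 ≤ ∫ y in frontier Ω, G y ∂μHE[d] := integral_nonneg hG0
  positivity

section

variable {d : ℕ} {Ω : Set E} {n : E → E} {E₀ : Set E}

lemma HasLocalGauss.isFiniteMeasure (h : HasLocalGauss d Ω n E₀) :
    IsFiniteMeasure ((μHE[d] : Measure E).restrict (frontier Ω)) :=
  ⟨by rw [Measure.restrict_apply_univ]; exact h.measure_lt_top⟩

lemma HasLocalGauss.integrable_mul_inner (h : HasLocalGauss d Ω n E₀) {G : E → ℝ}
    (hG : Integrable G (μHE[d].restrict (frontier Ω))) (e : E) :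
    Integrable (fun y => G y * ⟪n y, e⟫) (μHE[d].restrict (frontier Ω)) := by
  refine hG.mul_bdd (c := ‖e‖) (h.aestronglyMeasurable.inner aestronglyMeasurable_const)
    (Eventually.of_forall fun y => ?_)
  refine (norm_inner_le_norm _ _).trans ?_
  exact mul_le_of_le_one_left (norm_nonneg e) (h.norm_le_one y)

lemma HasLocalGauss.integrableOn_frontier (h : HasLocalGauss d Ω n E₀) {G : E → ℝ}
    (hG : Continuous G) : Integrable G (μHE[d].restrict (frontier Ω)) := by
  have := h.isFiniteMeasure
  have hc : IsCompact (frontier Ω) :=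
    h.isBounded.isCompact_closure.of_isClosed_subset isClosed_frontier frontier_subset_closure
  obtain ⟨C, hC⟩ := hc.exists_bound_of_continuousOn hG.continuousOn
  exact Integrable.of_bound hG.aestronglyMeasurable C
    ((ae_restrict_iff' isClosed_frontier.measurableSet).2 (Eventually.of_forall hC))

lemma HasLocalGauss.integrableOn_self (h : HasLocalGauss d Ω n E₀) {G : E → ℝ}
    (hG : Continuous G) : IntegrableOn G Ω :=
  (hG.continuousOn.integrableOn_compact h.isBounded.isCompact_closure).mono_set subset_closure

/-- A partition of unity turns the local approximate formulas into an approximate formula for all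
functions supported away from the exceptional set; the error being relative to the total surface
integral, it can be made arbitrarily small. -/
lemma HasLocalGauss.gauss_of_disjoint (h : HasLocalGauss d Ω n E₀) {G : E → ℝ}
    (hG : ContDiff ℝ 1 G) (hGc : HasCompactSupport G) (hG0 : ∀ z, 0 ≤ G z)
    (hGd : Disjoint (tsupport G) E₀) (e : E) :
    ∫ z in Ω, fderiv ℝ G z e = ∫ y in frontier Ω, G y * ⟪n y, e⟫ ∂μHE[d] := by
  have key : ∀ ε > 0, |(∫ z in Ω, fderiv ℝ G z e) - ∫ y in frontier Ω, G y * ⟪n y, e⟫ ∂μHE[d]|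
      ≤ ε * (‖e‖ * ∫ y in frontier Ω, G y ∂μHE[d]) := by
    intro ε hε
    have hcov : ∀ y : tsupport G, ∃ U, IsOpen U ∧ (y : E) ∈ U ∧ GaussUpTo d Ω n ε U := by
      rintro ⟨y, hy⟩
      by_cases hyΩ : y ∈ Ω
      · exact ⟨Ω, h.isOpen, hyΩ, gaussUpTo_self h.isOpen n hε.le⟩
      by_cases hyc : y ∈ closure Ω
      · refine h.gauss y ?_ (Set.disjoint_left.1 hGd hy) ε hε
        rw [h.isOpen.frontier_eq]
        exact ⟨hyc, hyΩ⟩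
      · exact ⟨(closure Ω)ᶜ, isClosed_closure.isOpen_compl, hyc,
          gaussUpTo_compl_closure Ω n hε.le⟩
    choose U hUo hyU hU using hcov
    obtain ⟨t, ht⟩ := hGc.isCompact.elim_finite_subcover U hUo
      fun y hy => mem_iUnion.2 ⟨⟨y, hy⟩, hyU _⟩
    obtain ⟨f, hf⟩ := SmoothPartitionOfUnity.exists_isSubordinate 𝓘(ℝ, E) (isClosed_tsupport G)
      (fun i : t => U i) (fun i => hUo i) (by simpa [iUnion_subtype] using ht)
    have hfs : ∀ i, ContDiff ℝ 1 (f i) := fun i =>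
      (contMDiff_iff_contDiff.1 (f i).contMDiff).of_le (by exact_mod_cast le_top)
    have hfG : ∀ i, ContDiff ℝ 1 (fun z => f i z * G z) := fun i => (hfs i).mul hG
    have hsum : ∀ z, G z = ∑ i, f i z * G z := by
      intro z
      rw [← Finset.sum_mul]
      by_cases hz : z ∈ tsupport G
      · rw [← finsum_eq_sum_of_fintype, f.sum_eq_one hz, one_mul]
      · rw [image_eq_zero_of_notMem_tsupport hz, mul_zero]
    have hloc : ∀ i, |(∫ z in Ω, fderiv ℝ (fun z => f i z * G z) z e)
        - ∫ y in frontier Ω, (f i y * G y) * ⟪n y, e⟫ ∂μHE[d]|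
        ≤ ε * ‖e‖ * ∫ y in frontier Ω, f i y * G y ∂μHE[d] := by
      intro i
      refine hU i _ (hfG i) hGc.mul_left ?_ (fun z => mul_nonneg (f.nonneg i z) (hG0 z)) e
      exact (tsupport_mul_subset_left).trans (hf i)
    have e1 : ∫ z in Ω, fderiv ℝ G z e = ∑ i, ∫ z in Ω, fderiv ℝ (fun z => f i z * G z) z e := by
      rw [← integral_finsetSum]
      · refine integral_congr_ae (Eventually.of_forall fun z => ?_)
        have hG' : G = fun z => ∑ i, f i z * G z := funext hsum
        have := fderiv_fun_sum (𝕜 := ℝ) (u := Finset.univ) (A := fun i z => f i z * G z) (x := z)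
          fun i _ => (hfG i).differentiable one_ne_zero z
        rw [← hG'] at this
        simp only [this, _root_.sum_apply]
      · exact fun i _ => h.integrableOn_self
          (((hfG i).continuous_fderiv one_ne_zero).clm_apply continuous_const)
    have e2 : ∫ y in frontier Ω, G y * ⟪n y, e⟫ ∂μHE[d]
        = ∑ i, ∫ y in frontier Ω, (f i y * G y) * ⟪n y, e⟫ ∂μHE[d] := by
      rw [← integral_finsetSum]
      · refine integral_congr_ae (Eventually.of_forall fun y => ?_)
        simp only
        rw [← Finset.sum_mul, ← hsum]
      · exact fun i _ => h.integrable_mul_inner (h.integrableOn_frontier (hfG i).continuous) e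
    have e3 : ∫ y in frontier Ω, G y ∂μHE[d] = ∑ i, ∫ y in frontier Ω, f i y * G y ∂μHE[d] := by
      rw [← integral_finsetSum]
      · exact integral_congr_ae (Eventually.of_forall hsum)
      · exact fun i _ => h.integrableOn_frontier (hfG i).continuous
    rw [e1, e2, e3, ← Finset.sum_sub_distrib, ← mul_assoc, Finset.mul_sum]
    exact (Finset.abs_sum_le_sum_abs _ _).trans (Finset.sum_le_sum fun i _ => hloc i)
  set M := ‖e‖ * ∫ y in frontier Ω, G y ∂μHE[d]
  have hlim : Tendsto (fun ε : ℝ => ε * M) (𝓝[>] 0) (𝓝 0) := by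
    have : Continuous fun ε : ℝ => ε * M := by fun_prop
    simpa using (this.tendsto 0).mono_left (nhdsWithin_le_nhds (s := Ioi 0))
  have := ge_of_tendsto hlim (eventually_mem_nhdsWithin.mono key)
  exact sub_eq_zero.1 (abs_nonpos_iff.1 this)

end

end GlobalGauss

/-! ### Null sets and the global Gauss formula -/

section Cover

/-- A compact set of `d`-dimensional measure zero can be covered by finitely many small balls
centred on it, with arbitrarily small `∑ rᵢ ^ d`. -/
lemma exists_finite_ball_cover {X : Type*} [MetricSpace X] [MeasurableSpace X] [BorelSpace X]
    {d : ℕ} (hd : 1 ≤ d) {K : Set X} (hK : IsCompact K) (hK0 : μHE[d] K = 0) {η : ℝ} (hη : 0 < η) :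
    ∃ (ι : Type) (_ : Fintype ι) (x : ι → X) (r : ι → ℝ),
      (∀ i, x i ∈ K ∧ 0 < r i ∧ r i < η) ∧ K ⊆ ⋃ i, ball (x i) (r i) ∧ ∑ i, r i ^ d < η := by
  have hH : μH[(d : ℝ)] K = 0 := by
    rw [Measure.euclideanHausdorffMeasure_def, Measure.smul_apply, ENNReal.smul_def, smul_eq_mul,
      mul_eq_zero] at hK0
    exact hK0.resolve_left (by
      simpa using Measure.addHaarScalarFactor_volume_hausdorffMeasure_ne_zero d)
  rw [Measure.hausdorffMeasure_apply] at hH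
  -- the total of the `d`-th powers of the diameters stays below `κ`, and the piece of index `n` is
  -- enlarged by `κ / 2 ^ n` so as to lie in an open ball of positive radius
  set κ : ℝ := min (min 1 (η / 4)) (η / (2 ^ d * 4)) with hκ
  have hκ0 : 0 < κ := by positivity
  have hκ1 : κ ≤ 1 := (min_le_left _ _).trans (min_le_left _ _)
  have hκη : κ ≤ η / 4 := (min_le_left _ _).trans (min_le_right _ _)
  have hκd : 2 ^ d * (4 * κ) ≤ η := by
    have : κ ≤ η / (2 ^ d * 4) := min_le_right _ _
    rw [le_div_iff₀ (by positivity)] at this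
    linarith
  have h1 := (ENNReal.iSup_eq_zero.1 hH) (ENNReal.ofReal (η / 4))
  have h2 := (ENNReal.iSup_eq_zero.1 h1) (by simpa using by linarith)
  have h3 : (⨅ (t : ℕ → Set X) (_ : K ⊆ ⋃ n, t n)
      (_ : ∀ n, ediam (t n) ≤ ENNReal.ofReal (η / 4)),
      ∑' n, ⨆ _ : (t n).Nonempty, ediam (t n) ^ (d : ℝ)) < ENNReal.ofReal κ := by
    rw [h2]; simpa using hκ0
  obtain ⟨t, ht⟩ := iInf_lt_iff.1 h3
  obtain ⟨htK, ht⟩ := iInf_lt_iff.1 ht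
  obtain ⟨htd, ht⟩ := iInf_lt_iff.1 ht
  have htop : ∀ n, ediam (t n) ≠ ⊤ := fun n => ((htd n).trans_lt ENNReal.ofReal_lt_top).ne
  set D : ℕ → ℝ := fun n => (ediam (t n)).toReal
  have hD0 : ∀ n, 0 ≤ D n := fun n => ENNReal.toReal_nonneg
  have hDη : ∀ n, D n ≤ η / 4 := fun n => ENNReal.toReal_le_of_le_ofReal (by linarith) (htd n)
  set ρ : ℕ → ℝ := fun n => κ * (1 / 2) ^ n
  have hρ0 : ∀ n, 0 < ρ n := fun n => by positivity
  have hρκ : ∀ n, ρ n ≤ κ := fun n =>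
    mul_le_of_le_one_right hκ0.le (pow_le_one₀ (by norm_num) (by norm_num))
  let I := {n : ℕ // (t n ∩ K).Nonempty}
  choose x hx using fun n : I => n.2
  obtain ⟨s, hs⟩ := hK.elim_finite_subcover (fun n : I => ball (x n) (D n + ρ n))
    (fun _ => isOpen_ball) (by
      intro y hy
      obtain ⟨n, hn⟩ := mem_iUnion.1 (htK hy)
      refine mem_iUnion.2 ⟨⟨n, ⟨y, hn, hy⟩⟩, ?_⟩
      have : dist y (x ⟨n, ⟨y, hn, hy⟩⟩) ≤ D n := by
        have h := edist_le_ediam_of_mem hn (hx ⟨n, ⟨y, hn, hy⟩⟩).1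
        rw [dist_edist]
        exact ENNReal.toReal_mono (htop n) h
      rw [mem_ball]
      have := hρ0 n
      simp only
      linarith)
  refine ⟨s, inferInstance, fun i => x i, fun i => D (i : I) + ρ (i : I), fun i => ⟨(hx i).2, ?_, ?_⟩,
    ?_, ?_⟩
  · have := hD0 (i : I); have := hρ0 (i : I); linarith
  · have := hDη (i : I); have := hρκ (i : I); linarith
  · simpa [iUnion_subtype] using hs
  have hsumD : ∑ i : s, D (i : I) ^ d ≤ κ := by
    have h4 : ∑ i : s, ENNReal.ofReal (D (i : I) ^ d) ≤ ENNReal.ofReal κ := by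
      refine le_trans ?_ ht.le
      have e : ∀ i : s, ENNReal.ofReal (D (i : I) ^ d)
          = ⨆ _ : (t (i : I)).Nonempty, ediam (t (i : I)) ^ (d : ℝ) := by
        intro i
        rw [iSup_pos (i : I).2.left, ENNReal.rpow_natCast, ENNReal.ofReal_pow (hD0 _),
          ENNReal.ofReal_toReal (htop _)]
      simp_rw [e]
      rw [← tsum_fintype (L := .unconditional s)]
      exact ENNReal.tsum_comp_le_tsum_of_injective
        (f := fun i : s => ((i : I) : ℕ)) (fun a b hab => Subtype.ext (Subtype.ext hab))
        (fun n => ⨆ _ : (t n).Nonempty, ediam (t n) ^ (d : ℝ))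
    rw [← ENNReal.ofReal_sum_of_nonneg fun i _ => pow_nonneg (hD0 _) d] at h4
    exact (ENNReal.ofReal_le_ofReal_iff hκ0.le).1 h4
  have hsumρ : ∑ i : s, ρ (i : I) ≤ 2 * κ := by
    have hsum : Summable ρ := (summable_geometric_of_lt_one (by norm_num) (by norm_num)).mul_left κ
    have h5 : ∑ i : s, ρ (i : I) ≤ ∑' n, ρ n := by
      rw [← tsum_fintype (L := .unconditional s)]
      exact tsum_comp_le_tsum_of_inj hsum (fun n => (hρ0 n).le)
        (i := fun i : s => ((i : I) : ℕ)) (fun a b hab => Subtype.ext (Subtype.ext hab))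
    rw [tsum_mul_left, tsum_geometric_two] at h5
    linarith
  calc ∑ i : s, (D (i : I) + ρ (i : I)) ^ d
      ≤ ∑ i : s, 2 ^ d * (D (i : I) ^ d + ρ (i : I)) := by
        refine Finset.sum_le_sum fun i _ => ?_
        refine (add_pow_le (hD0 _) (hρ0 _).le d).trans ?_
        have h6 : ρ (i : I) ^ d ≤ ρ (i : I) :=
          pow_le_of_le_one (hρ0 _).le ((hρκ _).trans hκ1) (by omega)
        have h7 : (2 : ℝ) ^ (d - 1) ≤ 2 ^ d := pow_le_pow_right₀ (by norm_num) (by omega)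
        have := pow_nonneg (hD0 (i : I)) d
        have := hρ0 (i : I)
        gcongr
    _ = 2 ^ d * (∑ i : s, D (i : I) ^ d + ∑ i : s, ρ (i : I)) := by
        rw [← Finset.mul_sum, Finset.sum_add_distrib]
    _ ≤ 2 ^ d * (κ + 2 * κ) := by gcongr
    _ < 2 ^ d * (4 * κ) := by
        have : (0 : ℝ) < 2 ^ d := by positivity
        nlinarith
    _ ≤ η := hκd

end Cover

section Removal

variable {E : Type*} [NormedAddCommGroup E] [InnerProductSpace ℝ E] [FiniteDimensional ℝ E]
  [MeasurableSpace E] [BorelSpace E]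

/-- Cutoffs that vanish near a compact set of codimension-one measure zero: their gradients are
small in `L¹`, because a ball of radius `r` contributes `r⁻¹ * r ^ (d + 1) = r ^ d`. -/
lemma exists_cutoff {d : ℕ} (hd : Module.finrank ℝ E = d + 1) (hd1 : 1 ≤ d) {K : Set E}
    (hK : IsCompact K) (hK0 : μHE[d] K = 0) (e : E) :
    ∃ C : ℝ, ∀ η > 0, ∃ χ : E → ℝ, ContDiff ℝ 1 χ ∧ (∀ z, 0 ≤ χ z) ∧ (∀ z, χ z ≤ 1) ∧
      (∃ V, IsOpen V ∧ K ⊆ V ∧ ∀ z ∈ V, χ z = 0) ∧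
      (∀ z, (∀ x ∈ K, 2 * η ≤ dist z x) → χ z = 1) ∧
      Integrable (fun z => fderiv ℝ χ z e) ∧ ∫ z, |fderiv ℝ χ z e| ≤ C * η := by
  let ψ : ContDiffBump (0 : E) := ⟨1, 2, by norm_num, by norm_num⟩
  have hψs : ContDiff ℝ 1 ψ := ψ.contDiff (n := 1)
  have hψc : Continuous fun z => fderiv ℝ ψ z e :=
    (hψs.continuous_fderiv one_ne_zero).clm_apply continuous_const
  have hψi : Integrable fun z => fderiv ℝ ψ z e :=
    hψc.integrable_of_hasCompactSupport (ψ.hasCompactSupport.fderiv_apply ℝ e)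
  refine ⟨∫ z, |fderiv ℝ ψ z e|, fun η hη => ?_⟩
  obtain ⟨ι, _, x, r, hxr, hKc, hsum⟩ := exists_finite_ball_cover hd1 hK hK0 hη
  classical
  set φ : ι → E → ℝ := fun i z => 1 - ψ ((r i)⁻¹ • (z - x i)) with hφ
  have hφd : ∀ i z, HasFDerivAt (φ i)
      (-((fderiv ℝ ψ ((r i)⁻¹ • (z - x i))).comp ((r i)⁻¹ • ContinuousLinearMap.id ℝ E))) z := by
    intro i z
    have h1 : HasFDerivAt (fun z => (r i)⁻¹ • (z - x i)) ((r i)⁻¹ • ContinuousLinearMap.id ℝ E) z :=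
      ((hasFDerivAt_id z).sub_const (x i)).const_smul _
    exact (((hψs.differentiable one_ne_zero _).hasFDerivAt).comp z h1).const_sub 1
  have hφs : ∀ i, ContDiff ℝ 1 (φ i) := fun i =>
    contDiff_const.sub (hψs.comp ((contDiff_id.sub contDiff_const).const_smul _))
  have hφ0 : ∀ i z, 0 ≤ φ i z := fun i z => sub_nonneg.2 ψ.le_one
  have hφ1 : ∀ i z, φ i z ≤ 1 := fun i z => sub_le_self _ ψ.nonneg
  have hχs : ContDiff ℝ 1 fun z => ∏ i, φ i z := contDiff_prod fun i _ => hφs i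
  -- the gradient of the product is dominated by the sum of the gradients of the factors
  have hbd : ∀ z, |fderiv ℝ (fun z => ∏ i, φ i z) z e|
      ≤ ∑ i, (r i)⁻¹ * |fderiv ℝ ψ ((r i)⁻¹ • (z - x i)) e| := by
    intro z
    have h1 := HasFDerivAt.finsetProd (u := Finset.univ) (g := φ) (x := z) fun i _ => hφd i z
    rw [h1.fderiv, _root_.sum_apply]
    refine (Finset.abs_sum_le_sum_abs _ _).trans (Finset.sum_le_sum fun i _ => ?_)
    have h2 : ∏ j ∈ Finset.univ.erase i, φ j z ≤ 1 :=
      Finset.prod_le_one (fun j _ => hφ0 j z) fun j _ => hφ1 j z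
    have h3 : 0 ≤ ∏ j ∈ Finset.univ.erase i, φ j z := Finset.prod_nonneg fun j _ => hφ0 j z
    have h4 : ((∏ j ∈ Finset.univ.erase i, φ j z) •
        -((fderiv ℝ ψ ((r i)⁻¹ • (z - x i))).comp ((r i)⁻¹ • ContinuousLinearMap.id ℝ E))) e
        = (∏ j ∈ Finset.univ.erase i, φ j z) *
          -((r i)⁻¹ * fderiv ℝ ψ ((r i)⁻¹ • (z - x i)) e) := by
      simp
    rw [h4, abs_mul, abs_neg, abs_mul, abs_of_nonneg h3, abs_of_pos (inv_pos.2 (hxr i).2.1)]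
    have := (inv_pos.2 (hxr i).2.1).le
    exact mul_le_of_le_one_left (by positivity) h2
  have hint : ∀ i, Integrable fun z => (r i)⁻¹ * |fderiv ℝ ψ ((r i)⁻¹ • (z - x i)) e| := by
    intro i
    have h1 := (hψi.abs.comp_smul (inv_pos.2 (hxr i).2.1).ne').comp_sub_right (x i)
    exact h1.const_mul _
  have hval : ∀ i, ∫ z, (r i)⁻¹ * |fderiv ℝ ψ ((r i)⁻¹ • (z - x i)) e|
      = r i ^ d * ∫ z, |fderiv ℝ ψ z e| := by
    intro i
    have hr := (hxr i).2.1
    rw [integral_const_mul,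
      integral_sub_right_eq_self (fun z => |fderiv ℝ ψ ((r i)⁻¹ • z) e|) (x i),
      Measure.integral_comp_inv_smul volume (fun z => |fderiv ℝ ψ z e|) (r i), hd,
      abs_of_pos (pow_pos hr _), smul_eq_mul, ← mul_assoc, pow_succ]
    field_simp
  have hint' := integrable_finsetSum Finset.univ fun i _ => hint i
  refine ⟨fun z => ∏ i, φ i z, hχs, fun z => Finset.prod_nonneg fun i _ => hφ0 i z,
    fun z => Finset.prod_le_one (fun i _ => hφ0 i z) fun i _ => hφ1 i z,
    ⟨⋃ i, ball (x i) (r i), isOpen_iUnion fun i => isOpen_ball, hKc, ?_⟩, ?_, ?_, ?_⟩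
  · intro z hz
    obtain ⟨i, hi⟩ := mem_iUnion.1 hz
    refine Finset.prod_eq_zero (Finset.mem_univ i) ?_
    have hr := (hxr i).2.1
    rw [mem_ball, dist_eq_norm] at hi
    have : ψ ((r i)⁻¹ • (z - x i)) = 1 := by
      refine ψ.one_of_mem_closedBall ?_
      rw [mem_closedBall, dist_zero_right, norm_smul, norm_inv, Real.norm_of_nonneg hr.le,
        inv_mul_le_iff₀ hr]
      change _ ≤ r i * 1
      linarith
    simp [hφ, this]
  · intro z hz
    refine Finset.prod_eq_one fun i _ => ?_
    have hr := (hxr i).2.1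
    have hzi := hz (x i) (hxr i).1
    have : ψ ((r i)⁻¹ • (z - x i)) = 0 := by
      refine ψ.zero_of_le_dist ?_
      rw [dist_zero_right, norm_smul, norm_inv, Real.norm_of_nonneg hr.le, ← dist_eq_norm,
        le_inv_mul_iff₀ hr]
      change r i * 2 ≤ _
      linarith [(hxr i).2.2]
    simp [hφ, this]
  · refine hint'.mono' ((hχs.continuous_fderiv one_ne_zero).clm_apply
      continuous_const).aestronglyMeasurable (Eventually.of_forall fun z => hbd z)
  · calc ∫ z, |fderiv ℝ (fun z => ∏ i, φ i z) z e|
        ≤ ∫ z, ∑ i, (r i)⁻¹ * |fderiv ℝ ψ ((r i)⁻¹ • (z - x i)) e| :=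
          integral_mono_of_nonneg (Eventually.of_forall fun z => abs_nonneg _) hint'
            (Eventually.of_forall hbd)
      _ = (∑ i, r i ^ d) * ∫ z, |fderiv ℝ ψ z e| := by
          rw [integral_finsetSum _ fun i _ => hint i, Finset.sum_mul]
          exact Finset.sum_congr rfl fun i _ => hval i
      _ ≤ η * ∫ z, |fderiv ℝ ψ z e| := by
          have : 0 ≤ ∫ z, |fderiv ℝ ψ z e| := integral_nonneg fun z => abs_nonneg _
          gcongr
      _ = _ := mul_comm _ _

variable {d : ℕ} {Ω : Set E} {n : E → E} {E₀ : Set E}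

/-- The exceptional set is removed by cutoffs. -/
lemma HasLocalGauss.gauss_of_nonneg (h : HasLocalGauss d Ω n E₀)
    (hd : Module.finrank ℝ E = d + 1) (hd1 : 1 ≤ d) {G : E → ℝ}
    (hG : ContDiff ℝ 1 G) (hGc : HasCompactSupport G) (hG0 : ∀ z, 0 ≤ G z) (e : E) :
    ∫ z in Ω, fderiv ℝ G z e = ∫ y in frontier Ω, G y * ⟪n y, e⟫ ∂μHE[d] := by
  obtain ⟨C, hC⟩ := exists_cutoff hd hd1 h.isCompact h.measure_zero e
  set u : ℕ → ℝ := fun k => 1 / ((k : ℝ) + 1) with hu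
  have hu0 : ∀ k, 0 < u k := fun k => Nat.one_div_pos_of_nat
  have hul : Tendsto u atTop (𝓝 0) := tendsto_one_div_add_atTop_nhds_zero_nat
  choose χ hχs hχ0 hχ1 hχV hχ hχi hχC using fun k => hC (u k) (hu0 k)
  have hlim : ∀ z ∉ E₀, Tendsto (fun k => χ k z) atTop (𝓝 1) := by
    intro z hz
    obtain ⟨ε, hε, hball⟩ := Metric.isOpen_iff.1 h.isCompact.isClosed.isOpen_compl z hz
    have hev : ∀ᶠ k in atTop, 2 * u k < ε := by
      have := hul.const_mul 2
      rw [mul_zero] at this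
      exact this.eventually (gt_mem_nhds hε)
    refine tendsto_const_nhds.congr' ?_
    filter_upwards [hev] with k hk
    refine (hχ k z fun x hx => ?_).symm
    by_contra hc
    exact hball (mem_ball'.2 (by linarith)) hx
  obtain ⟨M, hM⟩ := hG.continuous.bounded_above_of_compact_support hGc
  have hdG : Continuous fun z => fderiv ℝ G z e :=
    (hG.continuous_fderiv one_ne_zero).clm_apply continuous_const
  -- `χ k * G` is supported away from `E₀`, so the formula is known for it; in its derivative the
  -- term `G * ∂χ k` tends to `0` in `L¹`
  have hprod : ∀ k, ContDiff ℝ 1 fun z => χ k z * G z := fun k => (hχs k).mul hG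
  have hexact : ∀ k, ∫ z in Ω, fderiv ℝ (fun z => χ k z * G z) z e
      = ∫ y in frontier Ω, (χ k y * G y) * ⟪n y, e⟫ ∂μHE[d] := by
    intro k
    refine h.gauss_of_disjoint (hprod k) hGc.mul_left
      (fun z => mul_nonneg (hχ0 k z) (hG0 z)) ?_ e
    obtain ⟨V, hVo, hKV, hV⟩ := hχV k
    refine Set.disjoint_left.2 fun z hz hzE => ?_
    have : tsupport (fun z => χ k z * G z) ⊆ Vᶜ :=
      closure_minimal (fun w hw hwV => hw (by simp [hV w hwV])) hVo.isClosed_compl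
    exact this hz (hKV hzE)
  have hsplit : ∀ k, ∫ z in Ω, fderiv ℝ (fun z => χ k z * G z) z e
      = (∫ z in Ω, χ k z * fderiv ℝ G z e) + ∫ z in Ω, G z * fderiv ℝ (χ k) z e := by
    intro k
    have i1 : IntegrableOn (fun z => χ k z * fderiv ℝ G z e) Ω :=
      h.integrableOn_self ((hχs k).continuous.mul hdG)
    have i2 : IntegrableOn (fun z => G z * fderiv ℝ (χ k) z e) Ω :=
      h.integrableOn_self (hG.continuous.mul
        (((hχs k).continuous_fderiv one_ne_zero).clm_apply continuous_const))
    rw [← integral_add i1 i2]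
    refine integral_congr_ae (Eventually.of_forall fun z => ?_)
    simp only
    rw [fderiv_fun_mul ((hχs k).differentiable one_ne_zero z) (hG.differentiable one_ne_zero z)]
    simp
  have hl1 : Tendsto (fun k => ∫ z in Ω, χ k z * fderiv ℝ G z e) atTop
      (𝓝 (∫ z in Ω, fderiv ℝ G z e)) := by
    refine tendsto_integral_of_dominated_convergence (fun z => |fderiv ℝ G z e|)
      (fun k => ((hχs k).continuous.mul hdG).aestronglyMeasurable)
      (h.integrableOn_self hdG.abs) (fun k => Eventually.of_forall fun z => ?_)
      ((ae_restrict_iff' h.isOpen.measurableSet).2 (Eventually.of_forall fun z hz => ?_))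
    · rw [norm_mul, Real.norm_of_nonneg (hχ0 k z), Real.norm_eq_abs]
      exact mul_le_of_le_one_left (abs_nonneg _) (hχ1 k z)
    · have hzE : z ∉ E₀ := fun hzE => by
        have := h.subset hzE
        rw [h.isOpen.frontier_eq] at this
        exact this.2 hz
      simpa using (hlim z hzE).mul_const (fderiv ℝ G z e)
  have hl2 : Tendsto (fun k => ∫ z in Ω, G z * fderiv ℝ (χ k) z e) atTop (𝓝 0) := by
    have hb : ∀ k, ‖∫ z in Ω, G z * fderiv ℝ (χ k) z e‖ ≤ M * (C * u k) := by
      intro k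
      have hM0 : 0 ≤ M := (norm_nonneg _).trans (hM 0)
      calc ‖∫ z in Ω, G z * fderiv ℝ (χ k) z e‖
          ≤ ∫ z in Ω, M * |fderiv ℝ (χ k) z e| := by
            refine norm_integral_le_of_norm_le ((hχi k).abs.const_mul M).integrableOn
              (Eventually.of_forall fun z => ?_)
            rw [norm_mul, Real.norm_eq_abs (fderiv ℝ (χ k) z e)]
            exact mul_le_mul_of_nonneg_right (hM z) (abs_nonneg _)
        _ ≤ ∫ z, M * |fderiv ℝ (χ k) z e| :=
            setIntegral_le_integral ((hχi k).abs.const_mul M)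
              (Eventually.of_forall fun z => mul_nonneg hM0 (abs_nonneg _))
        _ ≤ M * (C * u k) := by
            rw [integral_const_mul]
            exact mul_le_mul_of_nonneg_left (hχC k) hM0
    refine squeeze_zero_norm hb ?_
    simpa using (hul.const_mul C).const_mul M
  have hl3 : Tendsto (fun k => ∫ y in frontier Ω, (χ k y * G y) * ⟪n y, e⟫ ∂μHE[d]) atTop
      (𝓝 (∫ y in frontier Ω, G y * ⟪n y, e⟫ ∂μHE[d])) := by
    have hGi := h.integrable_mul_inner (h.integrableOn_frontier hG.continuous) e
    refine tendsto_integral_of_dominated_convergence (fun y => |G y * ⟪n y, e⟫|)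
      (fun k => (h.integrable_mul_inner (h.integrableOn_frontier
        (hprod k).continuous) e).aestronglyMeasurable)
      hGi.abs (fun k => Eventually.of_forall fun y => ?_) ?_
    · rw [mul_assoc, norm_mul, Real.norm_of_nonneg (hχ0 k y), Real.norm_eq_abs]
      exact mul_le_of_le_one_left (abs_nonneg _) (hχ1 k y)
    · have hae : ∀ᵐ y ∂(μHE[d] : Measure E).restrict (frontier Ω), y ∉ E₀ :=
        ae_restrict_of_ae (measure_eq_zero_iff_ae_notMem.1 h.measure_zero)
      filter_upwards [hae] with y hy
      simp only [mul_assoc]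
      simpa using (hlim y hy).mul_const (G y * ⟪n y, e⟫)
  have := hl1.add hl2
  rw [add_zero] at this
  exact tendsto_nhds_unique (this.congr fun k => by rw [← hsplit, hexact]) hl3

/-- **Gauss formula** `∫_Ω ∂ₑG = ∫_{∂Ω} G ⟪n, e⟫ dS` for a domain with piecewise smooth
boundary. -/
theorem HasLocalGauss.integral_fderiv_eq (h : HasLocalGauss d Ω n E₀)
    (hd : Module.finrank ℝ E = d + 1) (hd1 : 1 ≤ d) {G : E → ℝ} (hG : ContDiff ℝ 1 G) (e : E) :
    ∫ z in Ω, fderiv ℝ G z e = ∫ y in frontier Ω, G y * ⟪n y, e⟫ ∂μHE[d] := by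
  obtain ⟨R, hR, hΩR⟩ : ∃ R > 0, closure Ω ⊆ ball 0 R := by
    obtain ⟨R, hR⟩ := h.isBounded.closure.subset_ball_lt 0 0
    exact ⟨R, hR.1, hR.2⟩
  let θ : ContDiffBump (0 : E) := ⟨R, R + 1, hR, by linarith⟩
  have hθs : ContDiff ℝ 1 θ := θ.contDiff (n := 1)
  have hθ1 : ∀ z ∈ ball (0 : E) R, θ z = 1 := fun z hz =>
    θ.one_of_mem_closedBall (ball_subset_closedBall hz)
  obtain ⟨M, hM⟩ := (isCompact_closedBall (0 : E) (R + 1)).exists_bound_of_continuousOn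
    hG.continuous.continuousOn
  have hM0 : 0 ≤ M := (norm_nonneg _).trans (hM 0 (mem_closedBall_self (by linarith)))
  -- on the support of `θ`, both `G + M` and the constant `M` are nonnegative
  have hs1 : ContDiff ℝ 1 fun z => θ z * G z + M * θ z :=
    (hθs.mul hG).add (contDiff_const.mul hθs)
  have hs2 : ContDiff ℝ 1 fun z => M * θ z := contDiff_const.mul hθs
  have hc2 : HasCompactSupport fun z => M * θ z := θ.hasCompactSupport.mul_left
  have hc1 : HasCompactSupport fun z => θ z * G z + M * θ z :=
    (θ.hasCompactSupport.mul_right (f' := G)).add hc2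
  have g1 := h.gauss_of_nonneg hd hd1 hs1 hc1 (fun z => ?_) e
  have g2 := h.gauss_of_nonneg hd hd1 hs2 hc2 (fun z => mul_nonneg hM0 θ.nonneg) e
  swap
  · by_cases hz : θ z = 0
    · rw [hz, zero_mul, mul_zero, add_zero]
    · have hzR : z ∈ closedBall (0 : E) (R + 1) := by
        by_contra hc
        rw [mem_closedBall, not_le] at hc
        exact hz (θ.zero_of_le_dist hc.le)
      have h1 := (abs_le.1 (hM z hzR)).1
      have h2 : 0 ≤ θ z := θ.nonneg
      nlinarith
  have e1 : ∫ z in Ω, fderiv ℝ (fun z => θ z * G z + M * θ z) z e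
      = (∫ z in Ω, fderiv ℝ G z e) + ∫ z in Ω, fderiv ℝ (fun z => M * θ z) z e := by
    rw [← integral_add (h.integrableOn_self
      ((hG.continuous_fderiv one_ne_zero).clm_apply continuous_const))
      (h.integrableOn_self ((hs2.continuous_fderiv one_ne_zero).clm_apply continuous_const))]
    refine setIntegral_congr_fun h.isOpen.measurableSet fun z hz => ?_
    have hev : (fun z => θ z * G z + M * θ z) =ᶠ[𝓝 z] fun z => G z + M * θ z := by
      filter_upwards [isOpen_ball.mem_nhds (hΩR (subset_closure hz))] with w hw
      rw [hθ1 w hw, one_mul]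
    rw [hev.fderiv_eq, fderiv_fun_add (hG.differentiable one_ne_zero z)
      (hs2.differentiable one_ne_zero z)]
    rfl
  have e2 : ∫ y in frontier Ω, (θ y * G y + M * θ y) * ⟪n y, e⟫ ∂μHE[d]
      = (∫ y in frontier Ω, G y * ⟪n y, e⟫ ∂μHE[d])
        + ∫ y in frontier Ω, (M * θ y) * ⟪n y, e⟫ ∂μHE[d] := by
    rw [← integral_add (h.integrable_mul_inner (h.integrableOn_frontier hG.continuous) e)
      (h.integrable_mul_inner (h.integrableOn_frontier hs2.continuous) e)]
    refine setIntegral_congr_fun isClosed_frontier.measurableSet fun y hy => ?_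
    rw [hθ1 y (hΩR (frontier_subset_closure hy))]
    ring
  linarith

end Removal

/-! ### Normals, patches and growth of surface measure -/

section Normal

variable {n m : ℕ} {Ω : Set (MSpace n m)}

lemma IsDefiningFunctionAt.gradient_ne_zero {y : MSpace n m} {ρ : MSpace n m → ℝ}
    (h : IsDefiningFunctionAt Ω y ρ) : gradient ρ y ≠ 0 := by
  intro h0
  refine h.2.2.1 ?_
  rwa [gradient, map_eq_zero_iff _ (LinearIsometryEquiv.injective _)] at h0

/-- A defining function at a boundary point is one at all nearby boundary points: it vanishes there,
since a sign would make the point interior or exterior. -/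
lemma IsDefiningFunctionAt.eventually {y₀ : MSpace n m} {ρ : MSpace n m → ℝ}
    (h : IsDefiningFunctionAt Ω y₀ ρ) :
    ∀ᶠ y in 𝓝 y₀, y ∈ frontier Ω → IsDefiningFunctionAt Ω y ρ := by
  obtain ⟨h1, -, h3, h4⟩ := h
  have hc : ContinuousAt (fderiv ℝ ρ) y₀ := h1.continuousAt_fderiv one_ne_zero
  filter_upwards [h1.eventually (by simp), hc.eventually_ne h3, eventually_eventually_nhds.2 h4]
    with y hy1 hy2 hy3 hyf
  refine ⟨hy1, ?_, hy2, hy3⟩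
  have hcy : ContinuousAt ρ y := hy1.continuousAt
  rw [frontier_eq_closure_inter_closure] at hyf
  refine le_antisymm (not_lt.1 fun hpos => ?_) (not_lt.1 fun hneg => ?_)
  · have hev : ∀ᶠ z in 𝓝 y, z ∉ Ω := by
      filter_upwards [hy3, hcy.eventually (lt_mem_nhds hpos)] with z hz hz'
      rw [hz]; exact not_lt.2 hz'.le
    obtain ⟨z, hz, hz'⟩ := ((mem_closure_iff_frequently.1 hyf.1).and_eventually hev).exists
    exact hz' hz
  · have hev : ∀ᶠ z in 𝓝 y, z ∈ Ω := by
      filter_upwards [hy3, hcy.eventually (gt_mem_nhds hneg)] with z hz hz'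
      rwa [hz]
    obtain ⟨z, hz, hz'⟩ := ((mem_closure_iff_frequently.1 hyf.2).and_eventually hev).exists
    exact hz hz'

lemma IsDefiningFunctionAt.hasDerivAt {y : MSpace n m} {ρ : MSpace n m → ℝ}
    (h : IsDefiningFunctionAt Ω y ρ) (w : MSpace n m) :
    HasDerivAt (fun t : ℝ => ρ (y + t • w)) ⟪gradient ρ y, w⟫ 0 := by
  have h1 : HasDerivAt (fun t : ℝ => y + t • w) w 0 := by
    simpa using ((hasDerivAt_id (0 : ℝ)).smul_const w).const_add y
  have h2 : HasFDerivAt ρ (fderiv ℝ ρ y) (y + (0 : ℝ) • w) := by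
    simpa using (h.1.differentiableAt one_ne_zero).hasFDerivAt
  have h3 := h2.comp_hasDerivAt 0 h1
  rwa [gradient, InnerProductSpace.toDual_symm_apply]

/-- A direction that strictly decreases one defining function enters `Ω`, hence cannot increase
another one to first order. -/
lemma IsDefiningFunctionAt.inner_gradient_nonpos {y : MSpace n m} {ρ ρ' : MSpace n m → ℝ}
    (h : IsDefiningFunctionAt Ω y ρ) (h' : IsDefiningFunctionAt Ω y ρ') {w : MSpace n m}
    (hw : ⟪gradient ρ y, w⟫ < 0) : ⟪gradient ρ' y, w⟫ ≤ 0 := by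
  have hl := (h.hasDerivAt w).tendsto_slope_zero_right
  have hl' := (h'.hasDerivAt w).tendsto_slope_zero_right
  have hline : Tendsto (fun t : ℝ => y + t • w) (𝓝[>] 0) (𝓝 y) := by
    have : Continuous fun t : ℝ => y + t • w := by fun_prop
    simpa using (this.tendsto 0).mono_left (nhdsWithin_le_nhds (s := Ioi 0))
  refine le_of_tendsto hl' ?_
  filter_upwards [hl.eventually (gt_mem_nhds hw), hline.eventually h.2.2.2,
    hline.eventually h'.2.2.2, self_mem_nhdsWithin] with t ht hΩ hΩ' ht0
  have ht0 : 0 < t := ht0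
  simp only [zero_add, zero_smul, add_zero, h.2.1, h'.2.1, sub_zero, smul_eq_mul] at ht ⊢
  have hneg : ρ (y + t • w) < 0 := by
    by_contra hc
    exact absurd ht (not_lt.2 (mul_nonneg (inv_pos.2 ht0).le (not_lt.1 hc)))
  have := hΩ'.1 (hΩ.2 hneg)
  exact mul_nonpos_of_nonneg_of_nonpos (inv_pos.2 ht0).le this.le

/-- The exterior unit normal does not depend on the defining function: two distinct unit vectors
`u`, `u'` satisfy `⟪u, u' - u⟫ < 0 < ⟪u', u' - u⟫`. -/
lemma IsExteriorUnitNormal.unique {y v v' : MSpace n m} (h : IsExteriorUnitNormal Ω y v)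
    (h' : IsExteriorUnitNormal Ω y v') : v = v' := by
  obtain ⟨ρ, hρ, rfl⟩ := h
  obtain ⟨ρ', hρ', rfl⟩ := h'
  set u := ‖gradient ρ y‖⁻¹ • gradient ρ y with hu
  set u' := ‖gradient ρ' y‖⁻¹ • gradient ρ' y with hu'
  have ha : 0 < ‖gradient ρ y‖ := norm_pos_iff.2 hρ.gradient_ne_zero
  have ha' : 0 < ‖gradient ρ' y‖ := norm_pos_iff.2 hρ'.gradient_ne_zero
  have hnu : ‖u‖ = 1 := by rw [hu, norm_smul, norm_inv, norm_norm, inv_mul_cancel₀ ha.ne']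
  have hnu' : ‖u'‖ = 1 := by rw [hu', norm_smul, norm_inv, norm_norm, inv_mul_cancel₀ ha'.ne']
  by_contra hne
  have hlt : ⟪u, u'⟫ < 1 := inner_lt_one_iff_real_of_norm_eq_one hnu hnu' |>.2 hne
  have h1 : ⟪gradient ρ y, u' - u⟫ < 0 := by
    have : ⟪u, u' - u⟫ < 0 := by
      rw [inner_sub_right, real_inner_self_eq_norm_sq, hnu]; linarith
    rw [hu, real_inner_smul_left, ← hu] at this
    by_contra hc
    exact absurd this (not_lt.2 (mul_nonneg (inv_pos.2 ha).le (not_lt.1 hc)))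
  have h2 := hρ.inner_gradient_nonpos hρ' h1
  have h3 : ⟪u', u' - u⟫ ≤ 0 := by
    nth_rewrite 1 [hu']
    rw [real_inner_smul_left]
    exact mul_nonpos_of_nonneg_of_nonpos (inv_pos.2 ha').le h2
  rw [inner_sub_right, real_inner_self_eq_norm_sq, hnu', real_inner_comm] at h3
  linarith

lemma IsDefiningFunctionAt.exteriorNormal_eq {y : MSpace n m} {ρ : MSpace n m → ℝ}
    (h : IsDefiningFunctionAt Ω y ρ) :
    exteriorNormal Ω y = ‖gradient ρ y‖⁻¹ • gradient ρ y := by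
  have hex : ∃ v, IsExteriorUnitNormal Ω y v := ⟨_, ρ, h, rfl⟩
  rw [exteriorNormal, dif_pos hex]
  exact hex.choose_spec.unique ⟨ρ, h, rfl⟩

lemma norm_exteriorNormal_le_one (Ω : Set (MSpace n m)) (y : MSpace n m) :
    ‖exteriorNormal Ω y‖ ≤ 1 := by
  by_cases hex : ∃ v, IsExteriorUnitNormal Ω y v
  · obtain ⟨v, ρ, hρ, -⟩ := hex
    rw [hρ.exteriorNormal_eq, norm_smul, norm_inv, norm_norm,
      inv_mul_cancel₀ (norm_ne_zero_iff.2 hρ.gradient_ne_zero)]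
  · rw [exteriorNormal, dif_neg hex]; simp

lemma IsDefiningFunctionAt.eventually_exteriorNormal_eq {y₀ : MSpace n m} {ρ : MSpace n m → ℝ}
    (h : IsDefiningFunctionAt Ω y₀ ρ) :
    ∀ᶠ y in 𝓝 y₀, y ∈ frontier Ω → exteriorNormal Ω y = ‖gradient ρ y‖⁻¹ • gradient ρ y :=
  h.eventually.mono fun _ hy hyf => (hy hyf).exteriorNormal_eq

lemma IsSmoothBoundaryPoint.continuousWithinAt_exteriorNormal {y : MSpace n m}
    (h : IsSmoothBoundaryPoint Ω y) :
    ContinuousWithinAt (exteriorNormal Ω) (frontier Ω) y := by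
  obtain ⟨ρ, hρ⟩ := h
  have hgc : ContinuousAt (gradient ρ) y :=
    (InnerProductSpace.toDual ℝ (MSpace n m)).symm.continuous.continuousAt.comp
      (hρ.1.continuousAt_fderiv one_ne_zero)
  have hnc : ContinuousAt (fun y => ‖gradient ρ y‖⁻¹ • gradient ρ y) y :=
    (hgc.norm.inv₀ (norm_ne_zero_iff.2 hρ.gradient_ne_zero)).smul hgc
  refine hnc.continuousWithinAt.congr_of_eventuallyEq ?_ hρ.exteriorNormal_eq
  rw [EventuallyEq, eventually_nhdsWithin_iff]
  exact hρ.eventually_exteriorNormal_eq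

end Normal

section Patches

variable {n m : ℕ} {Ω : Set (MSpace n m)}

/-- The surface measure of a bi-Lipschitz patch inside a ball of radius `r` is `O(r ^ d)`. -/
lemma measure_image_inter_closedBall_le {X : Type*} [MetricSpace X] [MeasurableSpace X]
    [BorelSpace X] {d : ℕ} {D : Set (EuclideanSpace ℝ (Fin d))}
    {φ : EuclideanSpace ℝ (Fin d) → X} {L : ℝ≥0} (hL : LipschitzOnWith L φ D) {c : ℝ}
    (hc : 0 < c) (hφ : ∀ u ∈ D, ∀ v ∈ D, c * dist u v ≤ dist (φ u) (φ v)) :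
    ∃ K : ℝ≥0, ∀ x, ∀ r > 0,
      μHE[d] (φ '' D ∩ closedBall x r) ≤ K * ENNReal.ofReal (r ^ d) := by
  set V := (volume (ball (0 : EuclideanSpace ℝ (Fin d)) 1)).toNNReal
  have hV : volume (ball (0 : EuclideanSpace ℝ (Fin d)) 1) = V :=
    (ENNReal.coe_toNNReal measure_ball_lt_top.ne).symm
  refine ⟨L ^ d * ((2 / c) ^ d).toNNReal * V, fun x r hr => ?_⟩
  rcases (φ '' D ∩ closedBall x r).eq_empty_or_nonempty with h0 | ⟨_, ⟨u₀, hu₀, rfl⟩, hu₀x⟩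
  · rw [h0, measure_empty]; exact zero_le
  have hsub : φ '' D ∩ closedBall x r ⊆ φ '' (D ∩ closedBall u₀ (2 / c * r)) := by
    rintro _ ⟨⟨u, hu, rfl⟩, hux⟩
    refine ⟨u, ⟨hu, ?_⟩, rfl⟩
    have h1 := hφ u hu u₀ hu₀
    have h2 : dist (φ u) (φ u₀) ≤ r + r :=
      (dist_triangle_right _ _ x).trans (add_le_add hux hu₀x)
    rw [mem_closedBall, div_mul_eq_mul_div, le_div_iff₀ hc]
    linarith
  calc μHE[d] (φ '' D ∩ closedBall x r)
      ≤ μHE[d] (φ '' (D ∩ closedBall u₀ (2 / c * r))) := measure_mono hsub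
    _ ≤ (L : ENNReal) ^ d * μHE[d] (D ∩ closedBall u₀ (2 / c * r)) :=
        euclideanHausdorffMeasure_image_le (hL.mono inter_subset_left) d
    _ ≤ (L : ENNReal) ^ d * volume (closedBall u₀ (2 / c * r)) := by
        rw [EuclideanSpace.euclideanHausdorffMeasure_eq_volume]
        gcongr
        exact inter_subset_right
    _ = _ := by
        rw [Measure.addHaar_closedBall _ _ (by positivity), finrank_euclideanSpace,
          Fintype.card_fin, hV, mul_pow, ENNReal.ofReal_mul (by positivity)]
        push_cast
        rw [ENNReal.ofReal]
        ring

/-- The surface measure of the part of the boundary in a ball of radius `r` is `O(r ^ d)`, uniformly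
in the centre. -/
lemma HasPiecewiseSmoothBoundary.exists_growth (h : HasPiecewiseSmoothBoundary Ω) :
    ∃ K : ℝ≥0, ∀ x, ∀ r > 0, μHE[n * (m + 1) - 1] (frontier Ω ∩ closedBall x r)
      ≤ K * ENNReal.ofReal (r ^ (n * (m + 1) - 1)) := by
  obtain ⟨p, D, φ, hΓ, hD⟩ := h.exists_patches
  have hex : ∀ i, ∃ K : ℝ≥0, ∀ x, ∀ r > 0,
      μHE[n * (m + 1) - 1] (φ i '' D i ∩ closedBall x r)
        ≤ K * ENNReal.ofReal (r ^ (n * (m + 1) - 1)) := by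
    intro i
    obtain ⟨-, -, ⟨c, C, hc, hcC⟩, -⟩ := hD i
    refine measure_image_inter_closedBall_le (L := C.toNNReal) ?_ hc
      fun u hu v hv => (hcC u hu v hv).1
    refine LipschitzOnWith.of_dist_le_mul fun u hu v hv => (hcC u hu v hv).2.trans ?_
    exact mul_le_mul_of_nonneg_right (Real.le_coe_toNNReal C) dist_nonneg
  choose K hK using hex
  refine ⟨∑ i, K i, fun x r hr => ?_⟩
  rw [hΓ, iUnion_inter]
  refine (measure_iUnion_fintype_le _ _).trans ?_
  push_cast
  rw [Finset.sum_mul]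
  exact Finset.sum_le_sum fun i _ => hK i x r hr

/-- The union of the edges `φᵢ(∂Dᵢ)` of the patches is a compact null set that contains all
non-smooth boundary points. -/
lemma HasPiecewiseSmoothBoundary.exists_null_edge (h : HasPiecewiseSmoothBoundary Ω) :
    ∃ E₀ ⊆ frontier Ω, IsCompact E₀ ∧ μHE[n * (m + 1) - 1] E₀ = 0 ∧
      ∀ y ∈ frontier Ω, y ∉ E₀ → IsSmoothBoundaryPoint Ω y := by
  obtain ⟨p, D, φ, hΓ, hD⟩ := h.exists_patches
  have hlip : ∀ i, ∃ L : ℝ≥0, LipschitzOnWith L (φ i) (D i) := by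
    intro i
    obtain ⟨-, -, ⟨c, C, hc, hcC⟩, -⟩ := hD i
    refine ⟨C.toNNReal, LipschitzOnWith.of_dist_le_mul fun u hu v hv =>
      (hcC u hu v hv).2.trans ?_⟩
    exact mul_le_mul_of_nonneg_right (Real.le_coe_toNNReal C) dist_nonneg
  have hfr : ∀ i, frontier (D i) ⊆ D i := fun i => (hD i).1.isClosed.frontier_subset
  refine ⟨⋃ i, φ i '' frontier (D i), ?_, ?_, ?_, ?_⟩
  · rw [hΓ]
    exact iUnion_mono fun i => image_mono (hfr i)
  · refine isCompact_iUnion fun i => ?_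
    obtain ⟨L, hL⟩ := hlip i
    exact ((hD i).1.of_isClosed_subset isClosed_frontier (hfr i)).image_of_continuousOn
      (hL.continuousOn.mono (hfr i))
  · refine measure_iUnion_null fun i => ?_
    obtain ⟨L, hL⟩ := hlip i
    have h1 := euclideanHausdorffMeasure_image_le (hL.mono (hfr i)) (n * (m + 1) - 1)
    rw [EuclideanSpace.euclideanHausdorffMeasure_eq_volume, (hD i).2.1, mul_zero] at h1
    exact le_antisymm h1 zero_le
  · intro y hy hyE
    rw [hΓ] at hy
    obtain ⟨i, u, hu, rfl⟩ := mem_iUnion.1 hy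
    refine (hD i).2.2.2 u ?_
    by_contra hc
    exact hyE (mem_iUnion.2 ⟨i, u, ⟨subset_closure hu, hc⟩, rfl⟩)

lemma finrank_mSpace (n m : ℕ) : Module.finrank ℝ (MSpace n m) = n * (m + 1) := by
  rw [finrank_euclideanSpace, Fintype.card_prod, Fintype.card_fin, Fintype.card_fin]

/-- Domains with piecewise smooth boundary satisfy the hypotheses of the Gauss formula. -/
lemma HasPiecewiseSmoothBoundary.exists_hasLocalGauss (h : HasPiecewiseSmoothBoundary Ω)
    (hn : 1 ≤ n) (hΩo : IsOpen Ω) (hΩ : Bornology.IsBounded Ω) :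
    ∃ E₀, HasLocalGauss (n * (m + 1) - 1) Ω (exteriorNormal Ω) E₀ := by
  obtain ⟨E₀, hE₀, hEc, hE0, hEs⟩ := h.exists_null_edge
  obtain ⟨K, hK⟩ := h.exists_growth
  have hpos : 1 ≤ n * (m + 1) := Nat.mul_pos hn (Nat.succ_pos m)
  have hd : Module.finrank ℝ (MSpace n m) = n * (m + 1) - 1 + 1 := by
    rw [finrank_mSpace, Nat.sub_add_cancel hpos]
  have hfin : μHE[n * (m + 1) - 1] (frontier Ω) < ⊤ := by
    obtain ⟨R, hR⟩ := hΩ.closure.subset_closedBall_lt 0 0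
    have h1 := hK 0 R hR.1
    rw [inter_eq_left.2 (frontier_subset_closure.trans hR.2)] at h1
    exact h1.trans_lt (ENNReal.mul_lt_top ENNReal.coe_lt_top ENNReal.ofReal_lt_top)
  have hmeas : AEStronglyMeasurable (exteriorNormal Ω)
      (μHE[n * (m + 1) - 1].restrict (frontier Ω)) := by
    have hc : ContinuousOn (exteriorNormal Ω) (frontier Ω \ E₀) := fun y hy =>
      (hEs y hy.1 hy.2).continuousWithinAt_exteriorNormal.mono sdiff_subset
    have h1 := hc.aestronglyMeasurable (μ := μHE[n * (m + 1) - 1])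
      (isClosed_frontier.measurableSet.diff hEc.measurableSet)
    rwa [Measure.restrict_congr_set (sdiff_null_ae_eq_self hE0)] at h1
  refine ⟨E₀, hΩo, hΩ, hfin, hmeas, norm_exteriorNormal_le_one Ω, hEc, hE0, hE₀, ?_⟩
  intro y hy hyE ε hε
  obtain ⟨ρ, hρ⟩ := hEs y hy hyE
  exact exists_gaussUpTo hd hΩo hΩ hfin hmeas (norm_exteriorNormal_le_one Ω) hρ.1 hρ.2.1
    hρ.gradient_ne_zero hρ.2.2.2 hρ.eventually_exteriorNormal_eq hε

end Patches

section Growth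

/-- If balls about `x` have measure `O(r ^ d)`, then `dist y x ^ (-p)` is integrable for
`p < d`. -/
lemma integrable_dist_rpow_neg {X : Type*} [PseudoMetricSpace X] [MeasurableSpace X]
    [OpensMeasurableSpace X] {μ : Measure X} [IsFiniteMeasure μ] {d : ℕ} {K : ℝ≥0} {x : X}
    (hμ : ∀ r > 0, μ (closedBall x r) ≤ K * ENNReal.ofReal (r ^ d)) {p : ℝ} (hp0 : 0 < p)
    (hpd : p < d) : Integrable (fun y => dist y x ^ (-p)) μ := by
  have hm : Measurable fun y => dist y x ^ (-p) :=
    (continuous_id.dist continuous_const).measurable.pow_const _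
  have h0 : ∀ y, 0 ≤ dist y x ^ (-p) := fun y => Real.rpow_nonneg dist_nonneg _
  refine ⟨hm.aestronglyMeasurable, ?_⟩
  rw [hasFiniteIntegral_iff_ofReal (Eventually.of_forall h0),
    lintegral_eq_lintegral_meas_lt μ (Eventually.of_forall h0) hm.aemeasurable]
  have hsplit : Ioi (0 : ℝ) = Ioc 0 1 ∪ Ioi 1 := (Ioc_union_Ioi_eq_Ioi zero_le_one).symm
  rw [hsplit]
  refine (lintegral_union_le _ _ _).trans_lt (ENNReal.add_lt_top.2 ⟨?_, ?_⟩)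
  · calc ∫⁻ t in Ioc (0 : ℝ) 1, μ {a | t < dist a x ^ (-p)}
        ≤ ∫⁻ _ in Ioc (0 : ℝ) 1, μ univ := lintegral_mono fun t => measure_mono (subset_univ _)
      _ < ⊤ := by
          rw [setLIntegral_const]
          exact ENNReal.mul_lt_top (measure_lt_top _ _) (by simp)
  · have hb : ∀ t ∈ Ioi (1 : ℝ), μ {a | t < dist a x ^ (-p)}
        ≤ K * ENNReal.ofReal (t ^ (-(d / p))) := by
      intro t ht
      have ht0 : 0 < t := zero_lt_one.trans ht
      have hr : 0 < t ^ (-p⁻¹) := Real.rpow_pos_of_pos ht0 _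
      have hsub : {a | t < dist a x ^ (-p)} ⊆ closedBall x (t ^ (-p⁻¹)) := by
        intro a ha
        have ha : t < dist a x ^ (-p) := ha
        rcases (dist_nonneg (x := a) (y := x)).eq_or_lt with h | h
        · rw [mem_closedBall, ← h]; exact hr.le
        have h1 : (dist a x ^ (-p)) ^ (-p⁻¹) ≤ t ^ (-p⁻¹) :=
          Real.rpow_le_rpow_of_nonpos ht0 ha.le (by simpa using hp0.le)
        rwa [← Real.rpow_mul h.le, neg_mul_neg, mul_inv_cancel₀ hp0.ne', Real.rpow_one] at h1
      refine (measure_mono hsub).trans ((hμ _ hr).trans (le_of_eq ?_))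
      rw [← Real.rpow_mul_natCast ht0.le]
      congr 3
      ring
    have hint : IntegrableOn (fun t : ℝ => t ^ (-(d / p))) (Ioi 1) := by
      refine integrableOn_Ioi_rpow_of_lt ?_ zero_lt_one
      rw [neg_lt_neg_iff, lt_div_iff₀ hp0, one_mul]
      exact hpd
    calc ∫⁻ t in Ioi (1 : ℝ), μ {a | t < dist a x ^ (-p)}
        ≤ ∫⁻ t in Ioi (1 : ℝ), K * ENNReal.ofReal (t ^ (-(d / p))) :=
          setLIntegral_mono' measurableSet_Ioi hb
      _ = K * ∫⁻ t in Ioi (1 : ℝ), ENNReal.ofReal (t ^ (-(d / p))) :=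
          lintegral_const_mul' _ _ ENNReal.coe_ne_top
      _ < ⊤ := ENNReal.mul_lt_top ENNReal.coe_lt_top hint.lintegral_lt_top

end Growth

/-! ### Boundary moments and flux of the kernel -/

section Flux

/-- A smooth function of `u` that equals `u ^ (-N / 2)` for `u ≥ δ ^ 2` and vanishes near `0`. -/
def cutPow (N : ℕ) (δ u : ℝ) : ℝ :=
  Real.smoothTransition (2 * u / δ ^ 2 - 1) * u ^ (-((N : ℝ) / 2))

lemma contDiff_cutPow (N : ℕ) {δ : ℝ} (hδ : 0 < δ) : ContDiff ℝ 1 (cutPow N δ) := by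
  rw [contDiff_iff_contDiffAt]
  intro u
  rcases lt_or_ge u (δ ^ 2 / 2) with hu | hu
  · have : cutPow N δ =ᶠ[𝓝 u] fun _ => 0 := by
      filter_upwards [gt_mem_nhds hu] with w hw
      rw [cutPow, Real.smoothTransition.zero_of_nonpos, zero_mul]
      rw [sub_nonpos, div_le_one (by positivity)]
      linarith
    exact contDiffAt_const.congr_of_eventuallyEq this
  · have hu0 : u ≠ 0 := (lt_of_lt_of_le (by positivity) hu).ne'
    refine ContDiffAt.mul ?_ (contDiffAt_id.rpow_const_of_ne hu0)
    exact (Real.smoothTransition.contDiffAt (n := 1)).comp u (by fun_prop)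

lemma cutPow_sq_of_le (N : ℕ) {δ r : ℝ} (hδ : 0 < δ) (hr : δ ≤ r) :
    cutPow N δ (r ^ 2) = (r ^ N)⁻¹ := by
  have hr0 : 0 < r := hδ.trans_le hr
  rw [cutPow, Real.smoothTransition.one_of_one_le, one_mul]
  · rw [← Real.rpow_natCast r 2, ← Real.rpow_mul hr0.le, ← Real.rpow_natCast r N,
      ← Real.rpow_neg hr0.le]
    congr 1
    push_cast
    ring
  · rw [le_sub_iff_add_le, le_div_iff₀ (by positivity)]
    nlinarith

/-- The radial profile of the divergence of `z ↦ cutPow N δ (‖z‖ ^ 2) • z` in dimension `N`. -/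
def cutDiv (N : ℕ) (δ r : ℝ) : ℝ :=
  2 * deriv (cutPow N δ) (r ^ 2) * r ^ 2 + N * cutPow N δ (r ^ 2)

lemma hasDerivAt_pow_mul_cutPow {N : ℕ} (hN : 1 ≤ N) {δ : ℝ} (hδ : 0 < δ) (r : ℝ) :
    HasDerivAt (fun r => r ^ N * cutPow N δ (r ^ 2)) (r ^ (N - 1) * cutDiv N δ r) r := by
  have h1 : HasDerivAt (cutPow N δ) (deriv (cutPow N δ) (r ^ 2)) (r ^ 2) :=
    ((contDiff_cutPow N hδ).differentiable one_ne_zero _).hasDerivAt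
  have h2 := (hasDerivAt_pow N r).mul
    (HasDerivAt.comp (h := fun r : ℝ => r ^ 2) r h1 (hasDerivAt_pow 2 r))
  refine h2.congr_deriv ?_
  obtain ⟨N, rfl⟩ : ∃ k, N = k + 1 := ⟨N - 1, by omega⟩
  simp only [cutDiv, Nat.add_sub_cancel, Function.comp]
  push_cast
  ring

/-- Outside the ball of radius `δ` the smoothed kernel is the kernel itself, which is
divergence-free. -/
lemma cutDiv_eq_zero {N : ℕ} (hN : 1 ≤ N) {δ r : ℝ} (hδ : 0 < δ) (hr : δ < r) :
    cutDiv N δ r = 0 := by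
  have hr0 : 0 < r := hδ.trans hr
  have h1 := hasDerivAt_pow_mul_cutPow hN hδ r
  have h2 : (fun r => r ^ N * cutPow N δ (r ^ 2)) =ᶠ[𝓝 r] fun _ => 1 := by
    filter_upwards [lt_mem_nhds hr] with s hs
    rw [cutPow_sq_of_le N hδ hs.le, mul_inv_cancel₀ (pow_pos (hδ.trans hs) N).ne']
  have h3 := h1.unique ((hasDerivAt_const r (1 : ℝ)).congr_of_eventuallyEq h2)
  exact (mul_eq_zero.1 h3).resolve_left (pow_pos hr0 _).ne'

lemma continuous_cutDiv (N : ℕ) {δ : ℝ} (hδ : 0 < δ) : Continuous (cutDiv N δ) := by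
  have h1 := (contDiff_cutPow N hδ).continuous
  have h2 := (contDiff_cutPow N hδ).continuous_deriv le_rfl
  unfold cutDiv
  fun_prop

/-- The total flux of the smoothed kernel, in polar coordinates: the primitive
`r ^ N * cutPow N δ (r ^ 2)` vanishes at `0` and equals `1` for `r ≥ δ`. -/
lemma integral_pow_mul_cutDiv {N : ℕ} (hN : 1 ≤ N) {δ : ℝ} (hδ : 0 < δ) :
    ∫ r in Ioi (0 : ℝ), r ^ (N - 1) * cutDiv N δ r = 1 := by
  have hcont : Continuous fun r => r ^ (N - 1) * cutDiv N δ r :=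
    (continuous_pow _).mul (continuous_cutDiv N hδ)
  have hint : IntegrableOn (fun r => r ^ (N - 1) * cutDiv N δ r) (Ioi 0) := by
    rw [← Ioc_union_Ioi_eq_Ioi hδ.le]
    refine IntegrableOn.union (hcont.integrableOn_Ioc) ?_
    refine integrableOn_zero.congr_fun (fun r hr => ?_) measurableSet_Ioi
    simp [cutDiv_eq_zero hN hδ hr]
  have hlim : Tendsto (fun r => r ^ N * cutPow N δ (r ^ 2)) atTop (𝓝 1) := by
    refine tendsto_const_nhds.congr' ?_
    filter_upwards [eventually_ge_atTop δ] with r hr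
    rw [cutPow_sq_of_le N hδ hr, mul_inv_cancel₀ (pow_pos (hδ.trans_le hr) N).ne']
  rw [integral_Ioi_of_hasDerivAt_of_tendsto'
    (fun r _ => hasDerivAt_pow_mul_cutPow hN hδ r) hint hlim]
  simp [zero_pow (by omega : N ≠ 0)]

lemma sphereArea_eq {ι : Type*} [Fintype ι] [Nonempty ι] :
    sphereArea (Fintype.card ι)
      = Fintype.card ι * volume.real (ball (0 : EuclideanSpace ℝ ι) 1) := by
  have hN : (0 : ℝ) < Fintype.card ι := by exact_mod_cast Fintype.card_pos
  have hΓ : 0 < Real.Gamma ((Fintype.card ι : ℝ) / 2) := Real.Gamma_pos_of_pos (by positivity)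
  rw [Measure.real, EuclideanSpace.volume_ball, ENNReal.ofReal_one, one_pow, one_mul,
    ENNReal.toReal_ofReal (div_nonneg (by positivity) (Real.Gamma_pos_of_pos (by positivity)).le),
    Real.Gamma_add_one (by positivity), sphereArea, Real.sqrt_eq_rpow, ← Real.rpow_natCast,
    ← Real.rpow_mul Real.pi_pos.le]
  rw [show 1 / 2 * (Fintype.card ι : ℝ) = (Fintype.card ι : ℝ) / 2 by ring]
  field_simp

lemma sphereArea_pos {N : ℕ} (hN : 1 ≤ N) : 0 < sphereArea N := by
  have : (0 : ℝ) < N := by exact_mod_cast hN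
  exact div_pos (by positivity) (Real.Gamma_pos_of_pos (by positivity))

lemma integral_cutDiv_norm {ι : Type*} [Fintype ι] [Nonempty ι] {δ : ℝ} (hδ : 0 < δ)
    (x : EuclideanSpace ℝ ι) :
    ∫ z, cutDiv (Fintype.card ι) δ ‖z - x‖ = sphereArea (Fintype.card ι) := by
  have hN : 1 ≤ Fintype.card ι := Fintype.card_pos
  rw [integral_sub_right_eq_self (fun z => cutDiv (Fintype.card ι) δ ‖z‖) x,
    integral_fun_norm_addHaar volume (cutDiv (Fintype.card ι) δ), finrank_euclideanSpace]
  simp only [smul_eq_mul, nsmul_eq_mul]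
  rw [integral_pow_mul_cutDiv hN hδ, mul_one, sphereArea_eq]

lemma fderiv_cutPow_mul {ι : Type*} [Fintype ι] [DecidableEq ι] (N : ℕ) {δ : ℝ} (hδ : 0 < δ)
    (x z : EuclideanSpace ℝ ι) (p q : ι) :
    fderiv ℝ (fun z : EuclideanSpace ℝ ι => cutPow N δ (‖z - x‖ ^ 2) * (z - x) p) z
        (EuclideanSpace.single q 1)
      = 2 * deriv (cutPow N δ) (‖z - x‖ ^ 2) * ((z - x) p * (z - x) q)
        + if p = q then cutPow N δ (‖z - x‖ ^ 2) else 0 := by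
  have h1 : HasFDerivAt (fun z : EuclideanSpace ℝ ι => ‖z - x‖ ^ 2)
      (2 • (innerSL ℝ (z - x))) z := by
    simpa using ((hasFDerivAt_id z).sub_const x).norm_sq
  have h2 : HasDerivAt (cutPow N δ) (deriv (cutPow N δ) (‖z - x‖ ^ 2)) (‖z - x‖ ^ 2) :=
    ((contDiff_cutPow N hδ).differentiable one_ne_zero _).hasDerivAt
  have h3 : HasFDerivAt (fun z : EuclideanSpace ℝ ι => (z - x) p)
      (EuclideanSpace.proj p : EuclideanSpace ℝ ι →L[ℝ] ℝ) z :=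
    (EuclideanSpace.proj p : EuclideanSpace ℝ ι →L[ℝ] ℝ).hasFDerivAt.comp z
      ((hasFDerivAt_id z).sub_const x)
  have h4 := (h2.comp_hasFDerivAt z h1).mul h3
  have h5 : fderiv ℝ (fun z : EuclideanSpace ℝ ι => cutPow N δ (‖z - x‖ ^ 2) * (z - x) p) z = _ :=
    h4.fderiv
  rw [h5]
  by_cases hpq : p = q
  · subst hpq
    simp [EuclideanSpace.inner_single_right, mul_comm, mul_left_comm]
    ring
  · simp [EuclideanSpace.inner_single_right, hpq, mul_comm, mul_left_comm]
    ring

/-- The coordinate of index `p` of the field `z / (σ_N |z| ^ N)` on `Mⁿ = ℝ ^ N`, the gradient of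
the fundamental solution of the Laplacian. -/
def scalarKernel {n m : ℕ} (p : Fin n × Fin (m + 1)) (z : MSpace n m) : ℝ :=
  1 / (sphereArea (n * (m + 1)) * ‖z‖ ^ (n * (m + 1))) * z p

variable {n m : ℕ} {Ω : Set (MSpace n m)} {E₀ : Set (MSpace n m)}

lemma exists_closedBall_subset_or {x : MSpace n m} (hΩ : IsOpen Ω) (hx : x ∉ frontier Ω) :
    ∃ δ > 0, (x ∈ Ω ∧ closedBall x δ ⊆ Ω) ∨ (x ∉ Ω ∧ closedBall x δ ⊆ (closure Ω)ᶜ) := by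
  by_cases hxΩ : x ∈ Ω
  · obtain ⟨δ, hδ, h⟩ := Metric.nhds_basis_closedBall.mem_iff.1 (hΩ.mem_nhds hxΩ)
    exact ⟨δ, hδ, Or.inl ⟨hxΩ, h⟩⟩
  · have hxc : x ∈ (closure Ω)ᶜ := fun hc => hx (by rw [hΩ.frontier_eq]; exact ⟨hc, hxΩ⟩)
    obtain ⟨δ, hδ, h⟩ := Metric.nhds_basis_closedBall.mem_iff.1
      (isClosed_closure.isOpen_compl.mem_nhds hxc)
    exact ⟨δ, hδ, Or.inr ⟨hxΩ, h⟩⟩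

lemma dist_gt_of_closedBall_subset {x y : MSpace n m} {δ : ℝ} (hΩ : IsOpen Ω)
    (h : (x ∈ Ω ∧ closedBall x δ ⊆ Ω) ∨ (x ∉ Ω ∧ closedBall x δ ⊆ (closure Ω)ᶜ))
    (hy : y ∈ frontier Ω) : δ < ‖y - x‖ := by
  by_contra hc
  rw [not_lt, ← dist_eq_norm] at hc
  have hyb : y ∈ closedBall x δ := hc
  rcases h with ⟨-, h⟩ | ⟨-, h⟩
  · rw [hΩ.frontier_eq] at hy; exact hy.2 (h hyb)
  · exact h hyb (frontier_subset_closure hy)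

/-- On the boundary the kernel may be replaced by a globally smooth field, to which the Gauss
formula applies. -/
lemma HasLocalGauss.integral_scalarKernel (h : HasLocalGauss (n * (m + 1) - 1) Ω
    (exteriorNormal Ω) E₀) (hN : 2 ≤ n * (m + 1)) {x : MSpace n m} {δ : ℝ} (hδ : 0 < δ)
    (hx : (x ∈ Ω ∧ closedBall x δ ⊆ Ω) ∨ (x ∉ Ω ∧ closedBall x δ ⊆ (closure Ω)ᶜ))
    (p q : Fin n × Fin (m + 1)) :
    ∫ y in frontier Ω, scalarKernel p (y - x) * exteriorNormal Ω y q ∂μHE[n * (m + 1) - 1]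
      = (sphereArea (n * (m + 1)))⁻¹ * ∫ z in Ω,
        (2 * deriv (cutPow (n * (m + 1)) δ) (‖z - x‖ ^ 2) * ((z - x) p * (z - x) q)
          + if p = q then cutPow (n * (m + 1)) δ (‖z - x‖ ^ 2) else 0) := by
  have hd : Module.finrank ℝ (MSpace n m) = n * (m + 1) - 1 + 1 := by
    rw [finrank_mSpace]; omega
  have hs : ContDiff ℝ 1 (fun z : MSpace n m =>
      cutPow (n * (m + 1)) δ (‖z - x‖ ^ 2) * (z - x) p) := by
    refine ContDiff.mul ?_ ?_
    · exact (contDiff_cutPow _ hδ).comp ((contDiff_norm_sq ℝ).comp (contDiff_id.sub contDiff_const))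
    · exact (EuclideanSpace.proj p : MSpace n m →L[ℝ] ℝ).contDiff.comp
        (contDiff_id.sub contDiff_const)
  have h1 := h.integral_fderiv_eq hd (by omega) hs (EuclideanSpace.single q 1)
  simp_rw [fderiv_cutPow_mul _ hδ] at h1
  rw [h1, ← integral_const_mul]
  refine setIntegral_congr_fun isClosed_frontier.measurableSet fun y hy => ?_
  have hy' := dist_gt_of_closedBall_subset h.isOpen hx hy
  simp only
  rw [cutPow_sq_of_le _ hδ hy'.le, EuclideanSpace.inner_single_right, scalarKernel, one_div,
    mul_inv]
  simp
  ring

/-- The kernel is curl-free, so the matrix of its boundary moments is symmetric. -/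
lemma HasLocalGauss.integral_scalarKernel_symm (h : HasLocalGauss (n * (m + 1) - 1) Ω
    (exteriorNormal Ω) E₀) (hN : 2 ≤ n * (m + 1)) {x : MSpace n m} (hx : x ∉ frontier Ω)
    (p q : Fin n × Fin (m + 1)) :
    ∫ y in frontier Ω, scalarKernel p (y - x) * exteriorNormal Ω y q ∂μHE[n * (m + 1) - 1]
      = ∫ y in frontier Ω, scalarKernel q (y - x) * exteriorNormal Ω y p ∂μHE[n * (m + 1) - 1] := by
  obtain ⟨δ, hδ, hxδ⟩ := exists_closedBall_subset_or h.isOpen hx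
  rw [h.integral_scalarKernel hN hδ hxδ, h.integral_scalarKernel hN hδ hxδ]
  congr 2
  ext z
  rw [mul_comm ((z - x) p)]
  congr 1
  simp only [eq_comm]

open Classical in
/-- The flux of the kernel through the boundary is `1` or `0` according to the position of the
pole. -/
lemma HasLocalGauss.sum_integral_scalarKernel (h : HasLocalGauss (n * (m + 1) - 1) Ω
    (exteriorNormal Ω) E₀) (hN : 2 ≤ n * (m + 1)) {x : MSpace n m} (hx : x ∉ frontier Ω) :
    ∑ p, ∫ y in frontier Ω, scalarKernel p (y - x) * exteriorNormal Ω y p ∂μHE[n * (m + 1) - 1]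
      = if x ∈ Ω then 1 else 0 := by
  obtain ⟨δ, hδ, hxδ⟩ := exists_closedBall_subset_or h.isOpen hx
  have hcard : Fintype.card (Fin n × Fin (m + 1)) = n * (m + 1) := by
    rw [Fintype.card_prod, Fintype.card_fin, Fintype.card_fin]
  have hne : Nonempty (Fin n × Fin (m + 1)) := Fintype.card_pos_iff.1 (by omega)
  have hσ := sphereArea_pos (N := n * (m + 1)) (by omega)
  simp_rw [h.integral_scalarKernel hN hδ hxδ]
  have hφ := contDiff_cutPow (n * (m + 1)) hδ
  have hnorm : Continuous fun z : MSpace n m => ‖z - x‖ ^ 2 := by fun_prop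
  have hcd : ∀ p : Fin n × Fin (m + 1), Continuous fun z : MSpace n m => (z - x) p := fun p =>
    (EuclideanSpace.proj p : MSpace n m →L[ℝ] ℝ).continuous.comp (continuous_id.sub continuous_const)
  rw [← Finset.mul_sum, ← integral_finsetSum]
  swap
  · intro p _
    refine h.integrableOn_self ?_
    simp only [if_true]
    exact ((continuous_const.mul ((hφ.continuous_deriv le_rfl).comp hnorm)).mul
      ((hcd p).mul (hcd p))).add (hφ.continuous.comp hnorm)
  have hdiv : ∀ z : MSpace n m, ∑ p,
      (2 * deriv (cutPow (n * (m + 1)) δ) (‖z - x‖ ^ 2) * ((z - x) p * (z - x) p)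
        + cutPow (n * (m + 1)) δ (‖z - x‖ ^ 2))
      = cutDiv (n * (m + 1)) δ ‖z - x‖ := by
    intro z
    have h2 : ∑ p, (z - x) p * (z - x) p = ‖z - x‖ ^ 2 := by
      rw [EuclideanSpace.norm_sq_eq]
      exact Finset.sum_congr rfl fun p _ => by rw [Real.norm_eq_abs, sq_abs, sq]
    rw [Finset.sum_add_distrib, ← Finset.mul_sum, h2, Finset.sum_const, Finset.card_univ, hcard,
      nsmul_eq_mul, cutDiv]
  simp only [if_true, hdiv]
  rcases hxδ with ⟨hxΩ, hb⟩ | ⟨hxΩ, hb⟩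
  · rw [if_pos hxΩ, setIntegral_eq_integral_of_forall_compl_eq_zero]
    · have := integral_cutDiv_norm hδ x
      rw [hcard] at this
      rw [this, inv_mul_cancel₀ hσ.ne']
    · intro z hz
      refine cutDiv_eq_zero (by omega) hδ ?_
      by_contra hc
      rw [not_lt, ← dist_eq_norm] at hc
      exact hz (hb hc)
  · rw [if_neg hxΩ, setIntegral_eq_zero_of_forall_eq_zero, mul_zero]
    intro z hz
    refine cutDiv_eq_zero (by omega) hδ ?_
    by_contra hc
    rw [not_lt, ← dist_eq_norm] at hc
    exact hb hc (subset_closure hz)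

end Flux

/-! ### Non-tangential limits of boundary moments -/

section NonTangential

variable {n m : ℕ} {Ω : Set (MSpace n m)}

/-- Within an approach region at `x`, the distance to the vertex is controlled by the distance to
the moving point, uniformly over the boundary. -/
lemma norm_le_of_mem_ntRegion {Γ D : Set (MSpace n m)} {κ : ℝ} {x x' y : MSpace n m}
    (hx' : x' ∈ ntRegion Γ D κ x) (hy : y ∈ Γ) : ‖y - x‖ ≤ (1 + |κ|) * ‖y - x'‖ := by
  have h1 : infDist x' Γ ≤ ‖y - x'‖ := by
    rw [← dist_eq_norm, dist_comm]; exact infDist_le_dist_of_mem hy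
  have h2 : ‖x' - x‖ ≤ |κ| * ‖y - x'‖ :=
    hx'.2.trans ((mul_le_mul_of_nonneg_right (le_abs_self κ) infDist_nonneg).trans
      (mul_le_mul_of_nonneg_left h1 (abs_nonneg κ)))
  have h3 : ‖y - x‖ ≤ ‖y - x'‖ + ‖x' - x‖ := norm_sub_le_norm_sub_add_norm_sub _ _ _
  linarith

/-- A truncated cone in `D` with vertex `x` makes `x` accessible non-tangentially from `D`. -/
lemma ContainsConeAt.exists_mem_closure_ntRegion {Γ D : Set (MSpace n m)} {x : MSpace n m}
    (h : ContainsConeAt D x) (hDΓ : Disjoint D Γ) (hx : x ∈ Γ) :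
    ∃ κ : ℝ, x ∈ closure (ntRegion Γ D κ x) := by
  obtain ⟨u, θ, r, hθ, hr, hcone⟩ := h
  refine ⟨‖u‖ / θ, ?_⟩
  have hlim : Tendsto (fun t : ℝ => x + t • u) (𝓝[>] 0) (𝓝 x) := by
    have : Continuous fun t : ℝ => x + t • u := by fun_prop
    simpa using (this.tendsto 0).mono_left (nhdsWithin_le_nhds (s := Ioi 0))
  refine mem_closure_of_tendsto hlim ?_
  filter_upwards [self_mem_nhdsWithin, mem_nhdsWithin_of_mem_nhds (gt_mem_nhds hr)] with t ht htr
  have ht : 0 < t := ht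
  refine ⟨hcone t ht htr u (by simpa using hθ), ?_⟩
  have h1 : t * θ ≤ infDist (x + t • u) Γ := by
    refine (le_infDist ⟨x, hx⟩).2 fun y hy => ?_
    by_contra hc
    rw [not_le, dist_eq_norm] at hc
    -- a boundary point this close would lie in the cone
    have hy' : y = x + t • (t⁻¹ • (y - x)) := by
      rw [smul_inv_smul₀ ht.ne']; abel
    refine Set.disjoint_left.1 hDΓ ?_ hy
    rw [hy']
    refine hcone t ht htr _ ?_
    have h2 : t⁻¹ • (y - x) - u = -(t⁻¹ • (x + t • u - y)) := by
      have : u = t⁻¹ • t • u := (inv_smul_smul₀ ht.ne' u).symm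
      nth_rewrite 1 [this]
      rw [← smul_sub, ← smul_neg]
      congr 1
      abel
    rw [h2, norm_neg, norm_smul, norm_inv, Real.norm_of_nonneg ht.le, inv_mul_lt_iff₀ ht]
    exact hc
  have h3 : x + t • u - x = t • u := by abel
  rw [h3, norm_smul, Real.norm_of_nonneg ht.le, div_mul_eq_mul_div, le_div_iff₀ hθ]
  nlinarith [mul_le_mul_of_nonneg_left h1 (norm_nonneg u)]

lemma measurable_scalarKernel (p : Fin n × Fin (m + 1)) :
    Measurable (scalarKernel p : MSpace n m → ℝ) := by
  unfold scalarKernel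
  have h : Measurable fun z : MSpace n m => z p :=
    (EuclideanSpace.proj p : MSpace n m →L[ℝ] ℝ).continuous.measurable
  exact (measurable_const.div (measurable_const.mul (measurable_norm.pow_const _))).mul h

lemma continuousAt_scalarKernel (hN : 1 ≤ n * (m + 1)) (p : Fin n × Fin (m + 1)) {z : MSpace n m}
    (hz : z ≠ 0) : ContinuousAt (scalarKernel p) z := by
  unfold scalarKernel
  have h : Continuous fun z : MSpace n m => z p :=
    (EuclideanSpace.proj p : MSpace n m →L[ℝ] ℝ).continuous
  refine ContinuousAt.mul (ContinuousAt.div continuousAt_const (by fun_prop) ?_) h.continuousAt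
  exact mul_ne_zero (sphereArea_pos hN).ne' (pow_ne_zero _ (norm_ne_zero_iff.2 hz))

lemma abs_scalarKernel_le (hN : 1 ≤ n * (m + 1)) (p : Fin n × Fin (m + 1)) (z : MSpace n m) :
    |scalarKernel p z| ≤ (sphereArea (n * (m + 1)))⁻¹ * (‖z‖ ^ (n * (m + 1) - 1))⁻¹ := by
  have hσ := sphereArea_pos hN
  rcases eq_or_ne z 0 with rfl | hz
  · simp only [scalarKernel]
    simp only [PiLp.zero_apply, mul_zero, abs_zero]
    positivity
  have hz0 : 0 < ‖z‖ := norm_pos_iff.2 hz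
  have h1 : |z p| ≤ ‖z‖ := by simpa using PiLp.norm_apply_le z p
  have h2 : ‖z‖ ^ (n * (m + 1)) = ‖z‖ ^ (n * (m + 1) - 1) * ‖z‖ := by
    rw [← pow_succ, Nat.sub_add_cancel hN]
  rw [scalarKernel, abs_mul, abs_of_nonneg (by positivity), h2, one_div, mul_inv, mul_inv,
    mul_assoc]
  refine mul_le_mul_of_nonneg_left ?_ (inv_pos.2 hσ).le
  rw [mul_assoc]
  refine mul_le_of_le_one_right (by positivity) ?_
  rw [inv_mul_le_iff₀ hz0, mul_one]
  exact h1

lemma abs_exteriorNormal_apply_le (y : MSpace n m) (q : Fin n × Fin (m + 1)) :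
    |exteriorNormal Ω y q| ≤ 1 := by
  refine le_trans ?_ (norm_exteriorNormal_le_one Ω y)
  simpa using PiLp.norm_apply_le (exteriorNormal Ω y) q

variable {E₀ : Set (MSpace n m)}

lemma HasLocalGauss.aestronglyMeasurable_apply {d : ℕ} {ν : MSpace n m → MSpace n m}
    (h : HasLocalGauss d Ω ν E₀) (q : Fin n × Fin (m + 1)) :
    AEStronglyMeasurable (fun y => ν y q) (μHE[d].restrict (frontier Ω)) :=
  (EuclideanSpace.proj q : MSpace n m →L[ℝ] ℝ).continuous.comp_aestronglyMeasurable
    h.aestronglyMeasurable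

/-- The scalar boundary moment `∫_Γ k_p(y - x) ν_q(y) g(y) dS(y)`. -/
def boundaryMoment (Ω : Set (MSpace n m)) (p q : Fin n × Fin (m + 1)) (g : MSpace n m → ℝ)
    (x : MSpace n m) : ℝ :=
  ∫ y in frontier Ω, scalarKernel p (y - x) * exteriorNormal Ω y q * g y ∂μHE[n * (m + 1) - 1]

lemma HasLocalGauss.integrable_moment (h : HasLocalGauss (n * (m + 1) - 1) Ω
    (exteriorNormal Ω) E₀) (hN : 1 ≤ n * (m + 1)) {x : MSpace n m} (hx : x ∉ frontier Ω)
    (p q : Fin n × Fin (m + 1)) {g : MSpace n m → ℝ} (hg : ContinuousOn g (frontier Ω)) :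
    Integrable (fun y => scalarKernel p (y - x) * exteriorNormal Ω y q * g y)
      (μHE[n * (m + 1) - 1].restrict (frontier Ω)) := by
  have := h.isFiniteMeasure
  have hc : IsCompact (frontier Ω) :=
    h.isBounded.isCompact_closure.of_isClosed_subset isClosed_frontier frontier_subset_closure
  have hk : ContinuousOn (fun y => scalarKernel p (y - x) * g y) (frontier Ω) := by
    refine ContinuousOn.mul (fun y hy => ?_) hg
    have hne : y - x ≠ 0 := sub_ne_zero.2 fun he => hx (he ▸ hy)
    have h1 : ContinuousAt (fun y : MSpace n m => y - x) y := by fun_prop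
    exact ((continuousAt_scalarKernel hN p hne).comp (f := fun y => y - x)
      h1).continuousWithinAt
  obtain ⟨C, hC⟩ := hc.exists_bound_of_continuousOn hk
  have hi : Integrable (fun y => scalarKernel p (y - x) * g y)
      (μHE[n * (m + 1) - 1].restrict (frontier Ω)) :=
    Integrable.of_bound (hk.aestronglyMeasurable isClosed_frontier.measurableSet) C
      ((ae_restrict_iff' isClosed_frontier.measurableSet).2 (Eventually.of_forall hC))
  have h2 := hi.mul_bdd (c := 1) (h.aestronglyMeasurable_apply q)
    (Eventually.of_forall fun y => abs_exteriorNormal_apply_le y q)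
  refine h2.congr (Eventually.of_forall fun y => ?_)
  simp only
  ring

/-- If the density vanishes to order `α` at the boundary point `x`, the moments converge
non-tangentially, from either side, to their (absolutely convergent) value at `x`. -/
lemma HasLocalGauss.tendsto_boundaryMoment (h : HasLocalGauss (n * (m + 1) - 1) Ω
    (exteriorNormal Ω) E₀) (hN : 2 ≤ n * (m + 1)) {K : ℝ≥0} {x : MSpace n m}
    (hK : ∀ r > 0, μHE[n * (m + 1) - 1] (frontier Ω ∩ closedBall x r)
      ≤ K * ENNReal.ofReal (r ^ (n * (m + 1) - 1)))
    (p q : Fin n × Fin (m + 1)) {g : MSpace n m → ℝ} (hg : ContinuousOn g (frontier Ω))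
    {α C : ℝ} (hα0 : 0 < α) (hα1 : α < 1)
    (hgC : ∀ y ∈ frontier Ω, |g y| ≤ C * ‖y - x‖ ^ α) (D : Set (MSpace n m))
    (κ : ℝ) :
    Tendsto (boundaryMoment Ω p q g) (𝓝[ntRegion (frontier Ω) D κ x] x)
      (𝓝 (boundaryMoment Ω p q g x)) := by
  have hN1 : 1 ≤ n * (m + 1) := by omega
  have hσ := sphereArea_pos hN1
  have := h.isFiniteMeasure
  set d := n * (m + 1) - 1 with hd
  have hd1 : (1 : ℝ) ≤ d := by exact_mod_cast (by omega : 1 ≤ d)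
  have hint : Integrable (fun y => dist y x ^ (-((d : ℝ) - α))) (μHE[d].restrict (frontier Ω)) := by
    refine integrable_dist_rpow_neg (d := d) (K := K) (fun r hr => ?_) (by linarith) (by linarith)
    rw [Measure.restrict_apply isClosed_closedBall.measurableSet, inter_comm]
    exact hK r hr
  set A : ℝ := (sphereArea (n * (m + 1)))⁻¹ * (1 + |κ|) ^ d * |C| with hA
  have hgm : AEStronglyMeasurable g (μHE[d].restrict (frontier Ω)) :=
    hg.aestronglyMeasurable isClosed_frontier.measurableSet
  have hgx : x ∈ frontier Ω → g x = 0 := fun hxf => by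
    have := hgC x hxf
    rw [sub_self, norm_zero, Real.zero_rpow hα0.ne', mul_zero] at this
    exact abs_nonpos_iff.1 this
  refine tendsto_integral_filter_of_dominated_convergence
    (fun y => A * dist y x ^ (-((d : ℝ) - α))) ?_ ?_ (hint.const_mul A) ?_
  · refine Eventually.of_forall fun x' => ?_
    exact ((((measurable_scalarKernel p).comp (measurable_id.sub_const x')).aestronglyMeasurable).mul
      (h.aestronglyMeasurable_apply q)).mul hgm
  · filter_upwards [self_mem_nhdsWithin] with x' hx'
    refine (ae_restrict_iff' isClosed_frontier.measurableSet).2 (Eventually.of_forall fun y hy => ?_)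
    rcases eq_or_ne y x with rfl | hne
    · rw [hgx hy, mul_zero, norm_zero]; positivity
    have hpos : 0 < ‖y - x‖ := norm_pos_iff.2 (sub_ne_zero.2 hne)
    have h1 := norm_le_of_mem_ntRegion hx' hy
    have hκ : 0 < 1 + |κ| := by positivity
    have hpos' : 0 < ‖y - x'‖ := by
      by_contra hc
      have : ‖y - x'‖ = 0 := le_antisymm (not_lt.1 hc) (norm_nonneg _)
      rw [this, mul_zero] at h1
      linarith
    have h2 : (‖y - x'‖ ^ d)⁻¹ ≤ (1 + |κ|) ^ d * (‖y - x‖ ^ d)⁻¹ := by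
      rw [← div_eq_mul_inv, le_div_iff₀ (by positivity), inv_mul_le_iff₀ (by positivity),
        mul_comm, ← mul_pow]
      exact pow_le_pow_left₀ hpos.le h1 d
    have h3 : dist y x ^ (-((d : ℝ) - α)) = (‖y - x‖ ^ d)⁻¹ * ‖y - x‖ ^ α := by
      rw [dist_eq_norm, show -((d : ℝ) - α) = -(d : ℝ) + α by ring, Real.rpow_add hpos,
        Real.rpow_neg hpos.le, Real.rpow_natCast]
    have h4 : |g y| ≤ |C| * ‖y - x‖ ^ α :=
      (hgC y hy).trans (mul_le_mul_of_nonneg_right (le_abs_self C) (by positivity))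
    have h5 := abs_scalarKernel_le hN1 p (y - x')
    rw [norm_mul, norm_mul, Real.norm_eq_abs, Real.norm_eq_abs, Real.norm_eq_abs, h3]
    calc |scalarKernel p (y - x')| * |exteriorNormal Ω y q| * |g y|
        ≤ ((sphereArea (n * (m + 1)))⁻¹ * ((1 + |κ|) ^ d * (‖y - x‖ ^ d)⁻¹)) * 1
            * (|C| * ‖y - x‖ ^ α) := by
          refine mul_le_mul (mul_le_mul ?_ (abs_exteriorNormal_apply_le y q) (abs_nonneg _)
            (by positivity)) h4 (abs_nonneg _) (by positivity)
          exact h5.trans (mul_le_mul_of_nonneg_left h2 (inv_pos.2 hσ).le)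
      _ = A * ((‖y - x‖ ^ d)⁻¹ * ‖y - x‖ ^ α) := by rw [hA]; ring
  · refine (ae_restrict_iff' isClosed_frontier.measurableSet).2 (Eventually.of_forall fun y hy => ?_)
    rcases eq_or_ne y x with rfl | hne
    · simp only [hgx hy, mul_zero]; exact tendsto_const_nhds
    have h1 : ContinuousAt (fun x' : MSpace n m => scalarKernel p (y - x')) x := by
      have h2 : ContinuousAt (fun x' : MSpace n m => y - x') x := by fun_prop
      exact (continuousAt_scalarKernel hN1 p (sub_ne_zero.2 hne)).comp (f := fun x' => y - x') h2
    exact ((h1.tendsto.mono_left nhdsWithin_le_nhds).mul_const _).mul_const _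

/-- Off the boundary a constant may be split off the density. -/
lemma HasLocalGauss.boundaryMoment_eq (h : HasLocalGauss (n * (m + 1) - 1) Ω
    (exteriorNormal Ω) E₀) (hN : 1 ≤ n * (m + 1)) {x : MSpace n m} (hx : x ∉ frontier Ω)
    (p q : Fin n × Fin (m + 1)) {g : MSpace n m → ℝ} (hg : ContinuousOn g (frontier Ω)) (c : ℝ) :
    boundaryMoment Ω p q g x = boundaryMoment Ω p q (fun y => g y - c) x
      + c * ∫ y in frontier Ω, scalarKernel p (y - x) * exteriorNormal Ω y q
        ∂μHE[n * (m + 1) - 1] := by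
  have h1 := h.integrable_moment hN hx p q (g := fun y => g y - c)
    (hg.sub continuousOn_const)
  have h2 := h.integrable_moment hN hx p q (continuousOn_const (c := c))
  rw [boundaryMoment, boundaryMoment, ← integral_const_mul]
  rw [← integral_add h1 (by simpa only [mul_comm c] using h2)]
  refine integral_congr_ae (Eventually.of_forall fun y => ?_)
  simp only
  ring

end NonTangential

/-! ### Alternativity and the algebra-valued integral -/

section Algebra

variable {A : Type*} [NonAssocRing A] [Module ℝ A] [IsScalarTower ℝ A A]
    [SMulCommClass ℝ A A] [StarRing A] [StarModule ℝ A] {m k n : ℕ}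

/-- Linearization of the left alternative law `(u * u) * a = u * (u * a)`. -/
lemma IsAlternative.add_mul_swap (hA : IsAlternative A) (u v a : A) :
    (u * v + v * u) * a = u * (v * a) + v * (u * a) := by
  have h := hA.left_alt (u + v) a
  have hu := hA.left_alt u a
  have hv := hA.left_alt v a
  simp only [add_mul, mul_add] at h ⊢
  rw [hu, hv] at h
  have h2 : u * (u * a) + v * (v * a) + (u * v * a + v * u * a)
      = u * (u * a) + v * (v * a) + (u * (v * a) + v * (u * a)) := by
    calc _ = u * (u * a) + v * u * a + (u * v * a + v * (v * a)) := by abel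
      _ = _ := h
      _ = _ := by abel
  exact add_left_cancel h2

variable {b : Module.Basis (Fin (m + 1) ⊕ Fin k) ℝ A}

lemma IsHypercomplexBasis.star_eq_neg (hb : IsHypercomplexBasis b) {s : Fin (m + 1)} (hs : s ≠ 0) :
    star (b (Sum.inl s)) = -b (Sum.inl s) :=
  (neg_eq_of_add_eq_zero_right (hb.mem_imaginaryUnits s hs).1).symm

lemma IsHypercomplexBasis.star_mul_mul_self (hA : IsAlternative A) (hb : IsHypercomplexBasis b)
    (s : Fin (m + 1)) (a : A) : star (b (Sum.inl s)) * (b (Sum.inl s) * a) = a := by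
  rcases eq_or_ne s 0 with rfl | hs
  · rw [hb.zero_eq_one, star_one, one_mul, one_mul]
  · have h1 := (hb.mem_imaginaryUnits s hs).2
    rw [hb.star_eq_neg hs] at h1 ⊢
    rw [neg_mul, ← hA.left_alt, ← neg_mul, ← mul_neg, h1, one_mul]

/-- The products `v_s^c (v_t a)` are antisymmetric in `s ≠ t`. -/
lemma IsHypercomplexBasis.star_mul_mul_add_swap (hA : IsAlternative A)
    (hb : IsHypercomplexBasis b) {s t : Fin (m + 1)} (hst : s ≠ t) (a : A) :
    star (b (Sum.inl s)) * (b (Sum.inl t) * a) + star (b (Sum.inl t)) * (b (Sum.inl s) * a) = 0 := by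
  rcases eq_or_ne s 0 with rfl | hs
  · rw [hb.zero_eq_one, star_one, one_mul, one_mul, hb.star_eq_neg hst.symm, neg_mul,
      add_neg_cancel]
  rcases eq_or_ne t 0 with rfl | ht
  · rw [hb.zero_eq_one, star_one, one_mul, one_mul, hb.star_eq_neg hst, neg_mul, neg_add_cancel]
  · rw [hb.star_eq_neg hs, hb.star_eq_neg ht, neg_mul, neg_mul, ← neg_add, ← hA.add_mul_swap,
      hb.anticomm s t hs ht hst, neg_add_cancel, zero_mul, neg_zero]

/-- Against a symmetric matrix only the diagonal products `v_s^c (v_s a) = a` survive. -/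
lemma IsHypercomplexBasis.sum_smul_star_mul_mul (hA : IsAlternative A)
    (hb : IsHypercomplexBasis b) {Q : Fin (m + 1) → Fin (m + 1) → ℝ} (hQ : ∀ s t, Q s t = Q t s)
    (a : A) : ∑ s, ∑ t, Q s t • (star (b (Sum.inl s)) * (b (Sum.inl t) * a))
      = (∑ s, Q s s) • a := by
  set X : Fin (m + 1) → Fin (m + 1) → A := fun s t =>
    star (b (Sum.inl s)) * (b (Sum.inl t) * a) with hX
  -- the sum equals its transpose, and adding the two cancels the off-diagonal terms
  have h1 : ∑ s, ∑ t, Q s t • X s t = ∑ s, ∑ t, Q s t • X t s := by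
    rw [Finset.sum_comm]
    exact Finset.sum_congr rfl fun s _ => Finset.sum_congr rfl fun t _ => by rw [hQ]
  have h2 : ∑ s, ∑ t, Q s t • X s t + ∑ s, ∑ t, Q s t • X s t = (2 : ℝ) • ((∑ s, Q s s) • a) := by
    nth_rewrite 2 [h1]
    rw [← Finset.sum_add_distrib, Finset.sum_smul, Finset.smul_sum]
    refine Finset.sum_congr rfl fun s _ => ?_
    rw [← Finset.sum_add_distrib, Finset.sum_eq_single s]
    · rw [two_smul]
      simp only [hX, hb.star_mul_mul_self hA]
    · intro t _ hts
      rw [← smul_add]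
      simp only [hX]
      rw [hb.star_mul_mul_add_swap hA hts.symm, smul_zero]
    · exact fun h => absurd (Finset.mem_univ s) h
  rw [← two_smul ℝ] at h2
  exact smul_right_injective A (two_ne_zero (α := ℝ)) h2

lemma kernelComponent_eq_sum (b : Module.Basis (Fin (m + 1) ⊕ Fin k) ℝ A) (j : Fin n)
    (z : MSpace n m) :
    kernelComponent b j z = ∑ s, scalarKernel (j, s) z • star (b (Sum.inl s)) := by
  rw [kernelComponent, component, star_sum, Finset.smul_sum]
  refine Finset.sum_congr rfl fun s _ => ?_
  rw [star_smul, star_trivial, smul_smul, scalarKernel]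

/-- The `A`-valued sum of products `v_s^c (v_t b_l)` with the coefficients `M`. -/
def structureSum (b : Module.Basis (Fin (m + 1) ⊕ Fin k) ℝ A)
    (M : Fin n → Fin (m + 1) → Fin (m + 1) → (Fin (m + 1) ⊕ Fin k) → ℝ) : A :=
  ∑ j, ∑ s, ∑ t, ∑ l, M j s t l • (star (b (Sum.inl s)) * (b (Sum.inl t) * b l))

lemma integrand_eq_structureSum (b : Module.Basis (Fin (m + 1) ⊕ Fin k) ℝ A)
    (Ω : Set (MSpace n m)) (f : MSpace n m → A) (x y : MSpace n m) :
    integrand b Ω f x y = structureSum b fun j s t l =>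
      scalarKernel (j, s) (y - x) * exteriorNormal Ω y (j, t) * b.repr (f y) l := by
  rw [integrand, structureSum]
  refine Finset.sum_congr rfl fun j _ => ?_
  rw [kernelComponent_eq_sum, component, Finset.sum_mul]
  refine Finset.sum_congr rfl fun s _ => ?_
  rw [Finset.sum_mul, Finset.mul_sum]
  refine Finset.sum_congr rfl fun t _ => ?_
  nth_rewrite 1 [← b.sum_repr (f y)]
  rw [Finset.mul_sum, Finset.mul_sum]
  refine Finset.sum_congr rfl fun l _ => ?_
  simp only [smul_mul_assoc, mul_smul_comm, smul_smul]
  congr 1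
  ring

lemma repr_structureSum (b : Module.Basis (Fin (m + 1) ⊕ Fin k) ℝ A)
    (M : Fin n → Fin (m + 1) → Fin (m + 1) → (Fin (m + 1) ⊕ Fin k) → ℝ) (i : Fin (m + 1) ⊕ Fin k) :
    b.repr (structureSum b M) i = ∑ j, ∑ s, ∑ t, ∑ l,
      M j s t l * b.repr (star (b (Sum.inl s)) * (b (Sum.inl t) * b l)) i := by
  simp only [structureSum, map_sum, map_smul, Finsupp.coe_finsetSum, Finset.sum_apply,
    Finsupp.smul_apply, smul_eq_mul]

lemma structureSum_add (b : Module.Basis (Fin (m + 1) ⊕ Fin k) ℝ A)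
    (M M' : Fin n → Fin (m + 1) → Fin (m + 1) → (Fin (m + 1) ⊕ Fin k) → ℝ) :
    structureSum b (fun j s t l => M j s t l + M' j s t l)
      = structureSum b M + structureSum b M' := by
  simp only [structureSum, add_smul, Finset.sum_add_distrib]

/-- Coefficients that factor through a matrix symmetric in each block act by its trace. -/
lemma structureSum_repr_mul (hA : IsAlternative A) (hb : IsHypercomplexBasis b)
    {Q : Fin n → Fin (m + 1) → Fin (m + 1) → ℝ} (hQ : ∀ j s t, Q j s t = Q j t s) (a : A) :
    structureSum b (fun j s t l => b.repr a l * Q j s t) = (∑ j, ∑ s, Q j s s) • a := by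
  rw [structureSum, Finset.sum_smul]
  refine Finset.sum_congr rfl fun j _ => ?_
  rw [← hb.sum_smul_star_mul_mul hA (hQ j)]
  refine Finset.sum_congr rfl fun s _ => Finset.sum_congr rfl fun t _ => ?_
  nth_rewrite 2 [← b.sum_repr a]
  rw [Finset.mul_sum, Finset.mul_sum, Finset.smul_sum]
  refine Finset.sum_congr rfl fun l _ => ?_
  rw [mul_smul_comm, mul_smul_comm, smul_smul, mul_comm]

lemma abs_repr_le_basisNorm (b : Module.Basis (Fin (m + 1) ⊕ Fin k) ℝ A) (a : A)
    (l : Fin (m + 1) ⊕ Fin k) : |b.repr a l| ≤ basisNorm b a := by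
  rw [basisNorm, ← Real.sqrt_sq_eq_abs]
  exact Real.sqrt_le_sqrt (Finset.single_le_sum (f := fun i => b.repr a i ^ 2)
    (fun i _ => sq_nonneg _) (Finset.mem_univ l))

lemma tendsto_basisNorm_structureSum_sub {X : Type*} {F : Filter X}
    {M : X → Fin n → Fin (m + 1) → Fin (m + 1) → (Fin (m + 1) ⊕ Fin k) → ℝ}
    {M₀ : Fin n → Fin (m + 1) → Fin (m + 1) → (Fin (m + 1) ⊕ Fin k) → ℝ}
    (h : ∀ j s t l, Tendsto (fun x => M x j s t l) F (𝓝 (M₀ j s t l))) :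
    Tendsto (fun x => basisNorm b (structureSum b (M x) - structureSum b M₀)) F (𝓝 0) := by
  have hi : ∀ i, Tendsto (fun x => b.repr (structureSum b (M x) - structureSum b M₀) i) F
      (𝓝 0) := by
    intro i
    have h1 : Tendsto (fun x => b.repr (structureSum b (M x)) i) F
        (𝓝 (b.repr (structureSum b M₀) i)) := by
      simp only [repr_structureSum]
      exact tendsto_finsetSum _ fun j _ => tendsto_finsetSum _ fun s _ =>
        tendsto_finsetSum _ fun t _ => tendsto_finsetSum _ fun l _ => (h j s t l).mul_const _
    simpa using h1.sub_const (b.repr (structureSum b M₀) i)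
  have h2 : Tendsto (fun x => ∑ i, b.repr (structureSum b (M x) - structureSum b M₀) i ^ 2) F
      (𝓝 (∑ i : Fin (m + 1) ⊕ Fin k, (0 : ℝ) ^ 2)) :=
    tendsto_finsetSum _ fun i _ => (hi i).pow 2
  have h3 := (Real.continuous_sqrt.tendsto _).comp h2
  have h0 : √(∑ _i : Fin (m + 1) ⊕ Fin k, (0 : ℝ) ^ 2) = 0 := by simp
  rw [h0] at h3
  exact h3

/-- Off the boundary the integral is a sum of scalar boundary moments. -/
lemma HasLocalGauss.bmIntegral_eq {Ω E₀ : Set (MSpace n m)} (h : HasLocalGauss (n * (m + 1) - 1) Ω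
    (exteriorNormal Ω) E₀) (hN : 1 ≤ n * (m + 1))
    (b : Module.Basis (Fin (m + 1) ⊕ Fin k) ℝ A) {f : MSpace n m → A}
    (hf : ∀ l, ContinuousOn (fun y => b.repr (f y) l) (frontier Ω)) {x : MSpace n m}
    (hx : x ∉ frontier Ω) :
    bmIntegral b Ω f x = structureSum b fun j s t l =>
      boundaryMoment Ω (j, s) (j, t) (fun y => b.repr (f y) l) x := by
  apply b.repr.injective
  ext i
  rw [bmIntegral, surfaceIntegral, b.repr_sum_self, repr_structureSum]
  have hint : ∀ j s t l, Integrable (fun y => scalarKernel (j, s) (y - x) *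
      exteriorNormal Ω y (j, t) * b.repr (f y) l *
        b.repr (star (b (Sum.inl s)) * (b (Sum.inl t) * b l)) i)
      (μHE[n * (m + 1) - 1].restrict (frontier Ω)) := fun j s t l =>
    (h.integrable_moment hN hx (j, s) (j, t) (hf l)).mul_const _
  simp only [integrand_eq_structureSum, repr_structureSum]
  rw [integral_finsetSum _ fun j _ => integrable_finsetSum _ fun s _ =>
    integrable_finsetSum _ fun t _ => integrable_finsetSum _ fun l _ => hint j s t l]
  refine Finset.sum_congr rfl fun j _ => ?_
  rw [integral_finsetSum _ fun s _ =>
    integrable_finsetSum _ fun t _ => integrable_finsetSum _ fun l _ => hint j s t l]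
  refine Finset.sum_congr rfl fun s _ => ?_
  rw [integral_finsetSum _ fun t _ => integrable_finsetSum _ fun l _ => hint j s t l]
  refine Finset.sum_congr rfl fun t _ => ?_
  rw [integral_finsetSum _ fun l _ => hint j s t l]
  refine Finset.sum_congr rfl fun l _ => ?_
  rw [integral_mul_const, boundaryMoment]

end Algebra

section Jump

variable {A : Type*} [NonAssocRing A] [Module ℝ A] [IsScalarTower ℝ A A]
    [SMulCommClass ℝ A A] [StarRing A] [StarModule ℝ A] {m k n : ℕ}
    {b : Module.Basis (Fin (m + 1) ⊕ Fin k) ℝ A}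

lemma IsHolderOn.continuousOn_repr {α : ℝ} (hα : 0 < α) {S : Set (MSpace n m)}
    {f : MSpace n m → A} (hf : IsHolderOn b α S f) (l : Fin (m + 1) ⊕ Fin k) :
    ContinuousOn (fun y => b.repr (f y) l) S := by
  obtain ⟨C, hC⟩ := hf
  intro y hy
  rw [ContinuousWithinAt, tendsto_iff_dist_tendsto_zero]
  have hlim : Tendsto (fun z => C * ‖z - y‖ ^ α) (𝓝[S] y) (𝓝 0) := by
    have : ContinuousAt (fun z : MSpace n m => C * ‖z - y‖ ^ α) y := by
      refine continuousAt_const.mul (ContinuousAt.rpow_const (by fun_prop) (Or.inr hα.le))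
    have h2 := this.tendsto.mono_left (nhdsWithin_le_nhds (s := S))
    simpa [Real.zero_rpow hα.ne'] using h2
  refine squeeze_zero' (Eventually.of_forall fun z => dist_nonneg) ?_ hlim
  filter_upwards [self_mem_nhdsWithin] with z hz
  rw [Real.dist_eq, ← Finsupp.sub_apply, ← map_sub]
  exact (abs_repr_le_basisNorm b _ l).trans (hC z hz y hy)

/-- Subtracting the constant `f x₀` from the density changes the integral by `f x₀` inside `Ω` and
by `0` outside. -/
lemma HasLocalGauss.bmIntegral_eq_add {Ω E₀ : Set (MSpace n m)}
    (h : HasLocalGauss (n * (m + 1) - 1) Ω (exteriorNormal Ω) E₀) (hN : 2 ≤ n * (m + 1))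
    (hA : IsAlternative A) (hb : IsHypercomplexBasis b) {f : MSpace n m → A}
    (hf : ∀ l, ContinuousOn (fun y => b.repr (f y) l) (frontier Ω)) (x₀ : MSpace n m)
    {x : MSpace n m} (hx : x ∉ frontier Ω) [Decidable (x ∈ Ω)] :
    bmIntegral b Ω f x = (structureSum b fun j s t l => boundaryMoment Ω (j, s) (j, t)
      (fun y => b.repr (f y) l - b.repr (f x₀) l) x) + (if x ∈ Ω then 1 else 0 : ℝ) • f x₀ := by
  have hN1 : 1 ≤ n * (m + 1) := by omega
  rw [h.bmIntegral_eq hN1 b hf hx]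
  have h1 : ∀ j s t l, boundaryMoment Ω (j, s) (j, t) (fun y => b.repr (f y) l) x = _ :=
    fun j s t l => h.boundaryMoment_eq hN1 hx (j, s) (j, t) (hf l) (b.repr (f x₀) l)
  simp only [h1]
  rw [structureSum_add, structureSum_repr_mul hA hb
    fun j s t => h.integral_scalarKernel_symm hN hx (j, s) (j, t)]
  congr 2
  have h2 := h.sum_integral_scalarKernel hN hx
  rw [Fintype.sum_prod_type] at h2
  rw [h2]
  congr

end Jump

end BochnerMartinelli

end

theorem mainTheorem4 {A : Type*} [NonAssocRing A] [Module ℝ A] [IsScalarTower ℝ A A]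
    [SMulCommClass ℝ A A] [StarRing A] [StarModule ℝ A]
    (hA : BochnerMartinelli.IsAlternative A)
    {m k n : ℕ} (hn : 1 ≤ n)
    (b : Module.Basis (Fin (m + 1) ⊕ Fin k) ℝ A)
    (hb : BochnerMartinelli.IsHypercomplexBasis b)
    (Ω : Set (BochnerMartinelli.MSpace n m))
    (hΩ_open : IsOpen Ω) (hΩ_conn : IsConnected Ω) (hΩ_bdd : Bornology.IsBounded Ω)
    (hΓ : BochnerMartinelli.HasPiecewiseSmoothBoundary Ω)
    (α : ℝ) (hα0 : 0 < α) (hα1 : α < 1)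
    (f : BochnerMartinelli.MSpace n m → A)
    (hf : BochnerMartinelli.IsHolderOn b α (frontier Ω) f) :
    ∀ x ∈ frontier Ω, ∃ Cplus Cminus : A,
      BochnerMartinelli.HasNTLimit b (frontier Ω) Ω
        (BochnerMartinelli.bmIntegral b Ω f) x Cplus ∧
      BochnerMartinelli.HasNTLimit b (frontier Ω) (closure Ω)ᶜ
        (BochnerMartinelli.bmIntegral b Ω f) x Cminus ∧
      Cplus - Cminus = f x := by
  open BochnerMartinelli in
  classical
  intro x hx
  have hN : 2 ≤ n * (m + 1) := by nlinarith [hb.one_le]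
  obtain ⟨E₀, hG⟩ := hΓ.exists_hasLocalGauss hn hΩ_open hΩ_bdd
  obtain ⟨K, hK⟩ := hΓ.exists_growth
  have hfc := fun l => hf.continuousOn_repr hα0 l
  obtain ⟨C, hC⟩ := hf
  set M : MSpace n m → Fin n → Fin (m + 1) → Fin (m + 1) → (Fin (m + 1) ⊕ Fin k) → ℝ :=
    fun x' j s t l => boundaryMoment Ω (j, s) (j, t)
      (fun y => b.repr (f y) l - b.repr (f x) l) x' with hM
  -- the Hölder part has the same limit, its value at `x`, from every side
  have hlim : ∀ (D : Set (MSpace n m)) (κ : ℝ), Tendsto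
      (fun x' => basisNorm b (structureSum b (M x') - structureSum b (M x)))
      (𝓝[ntRegion (frontier Ω) D κ x] x) (𝓝 0) := by
    intro D κ
    refine tendsto_basisNorm_structureSum_sub fun j s t l => ?_
    refine hG.tendsto_boundaryMoment hN (hK x) _ _ ((hfc l).sub continuousOn_const) hα0 hα1
      (C := C) (fun y hy => ?_) D κ
    change |b.repr (f y) l - b.repr (f x) l| ≤ _
    rw [← Finsupp.sub_apply, ← map_sub]
    exact (abs_repr_le_basisNorm b _ l).trans (hC y hy x hx)
  have hdisj : Disjoint Ω (frontier Ω) := by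
    rw [hΩ_open.frontier_eq]; exact Set.disjoint_sdiff_right
  have hdisj' : Disjoint (closure Ω)ᶜ (frontier Ω) :=
    Set.disjoint_left.2 fun y hy hyf => hy (frontier_subset_closure hyf)
  refine ⟨structureSum b (M x) + f x, structureSum b (M x), ⟨?_, fun κ => ?_⟩, ⟨?_, fun κ => ?_⟩,
    add_sub_cancel_left _ _⟩
  · exact (hΓ.cone_inside x hx).exists_mem_closure_ntRegion hdisj hx
  · refine (hlim Ω κ).congr' ?_
    filter_upwards [self_mem_nhdsWithin] with x' hx'
    rw [hG.bmIntegral_eq_add hN hA hb hfc x (Set.disjoint_left.1 hdisj hx'.1), if_pos hx'.1,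
      one_smul, add_sub_add_right_eq_sub]
  · exact (hΓ.cone_outside x hx).exists_mem_closure_ntRegion hdisj' hx
  · refine (hlim (closure Ω)ᶜ κ).congr' ?_
    filter_upwards [self_mem_nhdsWithin] with x' hx'
    rw [hG.bmIntegral_eq_add hN hA hb hfc x (Set.disjoint_left.1 hdisj' hx'.1),
      if_neg fun h => hx'.1 (subset_closure h), zero_smul, add_zero]
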